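/- Let $\Sigma\in\mathbb R^{d\times d}$ ($d\ge 1$) be symmetric positive semidefinite with positive diagonal entries. For $\lambda>0$ and a symmetric matrix $C$, the Graphical Lasso (GL) with input $C$ is the problem of minimizing $-\log\det S+\operatorname{trace}(CS)+\lambda\|S\|_{1,\mathrm{off}}$ over positive definite $S$, where $\|S\|_{1,\mathrm{off}}=\sum_{i\ne j}|S_{ij}|$. Let $f$ be this objective for $C=\Sigma$, $S^{\mathrm{opt}}$ its minimizer and $f^*=f(S^{\mathrm{opt}})$. Write $\|M\|_{\max}=\max_{i\neq j}|M_{ij}|$ (with value $0$ if $d=1$), and let $\mathrm{supp}(M)$ be the graph on $\{1,\dots,d\}$ joining $i\ne j$ iff $M_{ij}\ne 0$. Let $\Sigma^{\mathrm{res}}$ be the matrix with entries $\Sigma_{ij}-\lambda\,\mathrm{sign}(\Sigma_{ij})$ if $i\neq j$ and $|\Sigma_{ij}|>\lambda$, and $0$ otherwise; let $\tilde\Sigma^{\mathrm{res}}=D^{-1/2}\Sigma^{\mathrm{res}}D^{-1/2}$ with $D=\mathrm{diag}(\Sigma_{11},\dots,\Sigma_{dd})$; let $G=\mathrm{supp}(\Sigma^{\mathrm{res}})$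 with edge set $\mathcal E^{\mathrm{res}}$, and $\alpha=\|\tilde\Sigma^{\mathrm{res}}\|_{\max}$. Define the matrix $A=A(\lambda)$ by $$A_{ii}=\frac1{\Sigma_{ii}}\Big(1+\sum_{m:(i,m)\in\mathcal E^{\mathrm{res}}}\frac{(\Sigma^{\mathrm{res}}_{im})^2}{\Sigma_{ii}\Sigma_{mm}-(\Sigma^{\mathrm{res}}_{im})^2}\Big),\qquad A_{ij}=\frac{-\Sigma^{\mathrm{res}}_{ij}}{\Sigma_{ii}\Sigma_{jj}-(\Sigma^{\mathrm{res}}_{ij})^2}\ \text{ if }(i,j)\in\mathcal E^{\mathrm{res}},$$ and $A_{ij}=0$ otherwise. Let $\Sigma_{\max},\Sigma_{\min}$ be the largest and smallest diagonal entries of $\Sigma$, $\deg(G)$ the maximum degree of $G$, $P_{\max}(G)$ the maximum over pairs of vertices of the number of simple paths joining them, and $c(G)$ the length of a shortest cycle of $G$ ($+\infty$ if $G$ is acyclic, in which case $\alpha^{\lceil c(G)/2\rceil}$ is read as $0$). Put $$\delta=1+\frac{\deg(G)\,\alpha^2}{1-\alpha^2}+\frac{\deg(G)-1}{1-\alpha^2},\qquad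 \epsilon=\max\Big\{\Sigma_{\max},\sqrt{\tfrac{\Sigma_{\max}}{\Sigma_{\min}}}\Big\}\,\delta\,(P_{\max}(G)-1)\,\alpha^{\lceil c(G)/2\rceil}.$$ Finally let $d_{\max}(A)$ be the maximum number of vertices of a connected component of $\mathrm{supp}(A)$, let $\mu_{\min},\mu_{\max}$ be the smallest and largest eigenvalues, and $\|\cdot\|_2$ the spectral norm. **Theorem.** There is $\lambda_0>0$ (depending on $\Sigma$), with $\lambda_0<\|\Sigma\|_{\max}$ unless $\Sigma$ is diagonal, such that for every $\lambda\ge\lambda_0$: 1. there is a symmetric matrix $\hat\Sigma$ such that $A$ is the unique optimal solution of the GL with input $\hat\Sigma$ and $$\|\Sigma-\hat\Sigma\|_2\le d_{\max}(A)\Big(\frac1{\mu_{\min}(A)}+1\Big)\epsilon;$$ 2. the GL with input $\Sigma$ has a unique optimal solution $S^{\mathrm{opt}}$, and $$f(A)-f^*\le\big(\mu_{\max}(A)+\mu_{\max}(S^{\mathrm{opt}})\big)\,d_{\max}(A)\Big(\frac1{\mu_{\min}(A)}+1\Big)\epsilon.$$ -/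

import Mathlib

noncomputable section

namespace GraphicalLasso

/-- The off-diagonal `1`-norm: the sum of `|M i j|` over all entries minus the diagonal part. -/
def normOneOff {d : ℕ} (M : Matrix (Fin d) (Fin d) ℝ) : ℝ :=
  (∑ i, ∑ j, |M i j|) - ∑ i, |M i i|

/-- `max_{i ≠ j} |M i j|` (equal to `0` when there is no pair `i ≠ j`). -/
def normMaxOff {d : ℕ} (M : Matrix (Fin d) (Fin d) ℝ) : ℝ :=
  ⨆ p : {p : Fin d × Fin d // p.1 ≠ p.2}, |M p.1.1 p.1.2|

/-- The spectral norm `‖M‖₂`, i.e. the operator norm of `M` on Euclidean space. -/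
def normTwo {d : ℕ} (M : Matrix (Fin d) (Fin d) ℝ) : ℝ :=
  ‖Matrix.toEuclideanCLM (n := Fin d) (𝕜 := ℝ) M‖

/-- Smallest eigenvalue of a real symmetric matrix. -/
def muMin {d : ℕ} (M : Matrix (Fin d) (Fin d) ℝ) : ℝ := sInf (spectrum ℝ M)

/-- Largest eigenvalue of a real symmetric matrix. -/
def muMax {d : ℕ} (M : Matrix (Fin d) (Fin d) ℝ) : ℝ := sSup (spectrum ℝ M)

/-- The support graph of a symmetric matrix: distinct `i`, `j` are joined iff `M i j ≠ 0`. -/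
def supp {d : ℕ} (M : Matrix (Fin d) (Fin d) ℝ) : SimpleGraph (Fin d) :=
  SimpleGraph.fromRel fun i j => M i j ≠ 0

/-- The Graphical Lasso objective
`-log det S + trace (Sig S) + lam ‖S‖_{1,off}`, for positive definite `S`. -/
def objective {d : ℕ} (Sig : Matrix (Fin d) (Fin d) ℝ) (lam : ℝ)
    (S : Matrix (Fin d) (Fin d) ℝ) : ℝ :=
  -Real.log S.det + (Sig * S).trace + lam * normOneOff S

/-- `S` minimizes the Graphical Lasso objective. On singular positive semidefinite matrices
`-log det` is `+∞`, so the minimization takes place over the positive definite matrices. -/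
def IsSolution {d : ℕ} (Sig : Matrix (Fin d) (Fin d) ℝ) (lam : ℝ)
    (S : Matrix (Fin d) (Fin d) ℝ) : Prop :=
  S.PosDef ∧ ∀ S' : Matrix (Fin d) (Fin d) ℝ, S'.PosDef →
    objective Sig lam S ≤ objective Sig lam S'

/-- The residue of `Sig` relative to `lam` (off-diagonal soft thresholding, zero diagonal). -/
def residue {d : ℕ} (Sig : Matrix (Fin d) (Fin d) ℝ) (lam : ℝ) : Matrix (Fin d) (Fin d) ℝ :=
  Matrix.of fun i j =>
    if i ≠ j ∧ lam < |Sig i j| then Sig i j - lam * Real.sign (Sig i j) else 0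

/-- The normalized residue `D^{-1/2} * residue * D^{-1/2}`, `D` the diagonal part of `Sig`. -/
def normResidue {d : ℕ} (Sig : Matrix (Fin d) (Fin d) ℝ) (lam : ℝ) :
    Matrix (Fin d) (Fin d) ℝ :=
  Matrix.diagonal (fun i => (Real.sqrt (Sig i i))⁻¹) * residue Sig lam *
    Matrix.diagonal (fun i => (Real.sqrt (Sig i i))⁻¹)

open Classical in
/-- The explicit closed-form matrix `A`. -/
def closedForm {d : ℕ} (Sig : Matrix (Fin d) (Fin d) ℝ) (lam : ℝ) :
    Matrix (Fin d) (Fin d) ℝ :=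
  Matrix.of fun i j =>
    if i = j then
      1 / Sig i i *
        (1 + ∑ m ∈ Finset.univ.filter (fun m => (supp (residue Sig lam)).Adj i m),
          residue Sig lam i m ^ 2 / (Sig i i * Sig m m - residue Sig lam i m ^ 2))
    else if (supp (residue Sig lam)).Adj i j then
      -residue Sig lam i j / (Sig i i * Sig j j - residue Sig lam i j ^ 2)
    else 0

/-- The maximum, over all pairs of vertices, of the number of simple paths joining them. -/
def pMax {d : ℕ} (G : SimpleGraph (Fin d)) : ℕ :=
  Finset.univ.sup fun p : Fin d × Fin d => Nat.card (G.Path p.1 p.2)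

open Classical in
/-- The maximum vertex degree. -/
def maxDeg {d : ℕ} (G : SimpleGraph (Fin d)) : ℕ := G.maxDegree

/-- The maximum number of vertices of a connected component of the support graph of `M`. -/
def dMax {d : ℕ} (M : Matrix (Fin d) (Fin d) ℝ) : ℕ :=
  ⨆ c : (supp M).ConnectedComponent, c.supp.ncard

open Classical in
/-- `a ^ ⌈c(G)/2⌉`, where `c(G)` is the length of a shortest cycle of `G`. For acyclic `G`,
`c(G) = ∞` and the power of a number `0 ≤ a < 1` is `0`. -/
def girthPow {d : ℕ} (G : SimpleGraph (Fin d)) (a : ℝ) : ℝ :=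
  if G.IsAcyclic then 0 else a ^ ⌈(G.girth : ℝ) / 2⌉₊

/-- The constant `δ`. -/
def delta {d : ℕ} (Sig : Matrix (Fin d) (Fin d) ℝ) (lam : ℝ) : ℝ :=
  1 + (maxDeg (supp (residue Sig lam)) : ℝ) * normMaxOff (normResidue Sig lam) ^ 2 /
        (1 - normMaxOff (normResidue Sig lam) ^ 2)
    + ((maxDeg (supp (residue Sig lam)) : ℝ) - 1) /
        (1 - normMaxOff (normResidue Sig lam) ^ 2)

/-- The constant `ε`. -/
def eps {d : ℕ} (Sig : Matrix (Fin d) (Fin d) ℝ) (lam : ℝ) : ℝ :=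
  max (⨆ i, Sig i i) (Real.sqrt ((⨆ i, Sig i i) / (⨅ i, Sig i i))) * delta Sig lam *
    ((pMax (supp (residue Sig lam)) : ℝ) - 1) *
    girthPow (supp (residue Sig lam)) (normMaxOff (normResidue Sig lam))

end GraphicalLasso

end

/-!
After normalizing the diagonal of `Sig` to `1`, the closed form becomes the Bethe matrix of the
normalized residue `r`, with diagonal `1 + ∑ r² / (1 - r²)` and off-diagonal entries
`-r / (1 - r²)`. Its inverse is the generating function of weighted non-backtracking walks: for a
fixed target `j`, the quantities `dart r v a b`, rational in `r` and in the `j`-th column `v` of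
the inverse, satisfy the recursion of the walks that start with the step `a → b` (`dart_eq`).
Unrolling it (`abs_dart_le_of_walkFree`) bounds each quantity by a power of `d α` whose exponent is
the length of the shortest contributing walk, without summing any series. A closed non-backtracking
walk contains a cycle (`isPath_or_exists_isCycle`), so on the diagonal and on the edges the inverse
agrees with `1 + r` up to terms of order `α ^ girth` and `α ^ (girth - 1)`, and exactly if the
graph has no cycle. For girth at least `4` this beats `α ^ ⌈girth / 2⌉`; for girth `3` the orders
agree and the leading coefficient counts common neighbours, at most `P_max - 1` of them.

The threshold `lam0` is chosen so close to the largest off-diagonal entry of `Sig` that `α` is tiny,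
while the remaining entries of `Sig` stay below `lam` with room to spare
(`exists_forall_isLarge`). Changing `Sig` on the diagonal and on the edges only, by the error above,
yields an input for which the closed form satisfies the optimality conditions
(`isSolution_perturbedInput`), and these are sufficient by the tangent inequality for `log det`
(`isSolution_iff_of_kkt`). Schur's test turns the entrywise bound into a spectral one.

For the objective, `f(A) - f* ≤ trace ((Sig - SigHat) (A - Sopt))` by optimality of `A` in the
perturbed problem. A bound by norms alone would lose a factor `d`. Instead, the perturbation is of
higher order on the diagonal, and the off-diagonal entries of `A` and of the rescaled `Sopt` are
small: `Sopt` does at least as well as the inverse of the diagonal of `Sig`, and a near-maximizer of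
`log det N - trace N` has small off-diagonal entries, by comparison with its images under
transvections (`two_mul_abs_apply_le`).
-/

noncomputable section

namespace GraphicalLasso

open Finset Matrix

/-! ### The log-determinant inequality -/

/-- Each eigenvalue `μ > 0` contributes `μ - 1 - log μ ≥ 0`. -/
lemma log_det_le_trace_sub {d : ℕ} {N : Matrix (Fin d) (Fin d) ℝ} (hN : N.PosDef) :
    Real.log N.det ≤ N.trace - d := by
  rw [hN.1.det_eq_prod_eigenvalues, hN.1.trace_eq_sum_eigenvalues]
  simp only [RCLike.ofReal_real_eq_id, id]
  rw [Real.log_prod fun i _ => (hN.eigenvalues_pos i).ne']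
  calc _ ≤ ∑ i, (hN.1.eigenvalues i - 1) :=
        Finset.sum_le_sum fun i _ => Real.log_le_sub_one_of_pos (hN.eigenvalues_pos i)
    _ = _ := by simp

lemma eq_one_of_log_det_eq {d : ℕ} {N : Matrix (Fin d) (Fin d) ℝ} (hN : N.PosDef)
    (h : N.trace - d ≤ Real.log N.det) : N = 1 := by
  rw [hN.1.det_eq_prod_eigenvalues, hN.1.trace_eq_sum_eigenvalues] at h
  simp only [RCLike.ofReal_real_eq_id, id] at h
  rw [Real.log_prod fun i _ => (hN.eigenvalues_pos i).ne'] at h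
  have h1 : ∑ i, (hN.1.eigenvalues i - 1 - Real.log (hN.1.eigenvalues i)) = 0 := by
    refine le_antisymm ?_ (Finset.sum_nonneg fun i _ => ?_)
    · simp only [Finset.sum_sub_distrib, sum_const, card_univ, Fintype.card_fin, nsmul_eq_mul,
        mul_one]
      linarith
    · linarith [Real.log_le_sub_one_of_pos (hN.eigenvalues_pos i)]
  have h2 : ∀ i, hN.1.eigenvalues i = 1 := by
    intro i
    have h3 := (Finset.sum_eq_zero_iff_of_nonneg fun i _ => by
      linarith [Real.log_le_sub_one_of_pos (hN.eigenvalues_pos i)]).mp h1 i (mem_univ i)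
    by_contra hne
    linarith [Real.log_lt_sub_one_of_pos (hN.eigenvalues_pos i) hne]
  have h4 := hN.1.spectral_theorem
  have h5 : diagonal (RCLike.ofReal ∘ hN.1.eigenvalues : Fin d → ℝ) = 1 := by
    rw [← diagonal_one]
    congr 1
    ext i
    simp [h2 i]
  rw [h5, map_one] at h4
  exact h4

open scoped MatrixOrder in
lemma posSemidef_iff_eq_transpose_mul_self {d : ℕ} {W : Matrix (Fin d) (Fin d) ℝ} :
    W.PosSemidef ↔ ∃ B : Matrix (Fin d) (Fin d) ℝ, W = Bᵀ * B := by
  rw [← nonneg_iff_posSemidef]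
  exact CStarAlgebra.nonneg_iff_eq_star_mul_self

/-- A positive definite `W` factors as `Bᵀ B` with `B` invertible. -/
lemma exists_isUnit_transpose_mul {d : ℕ} {W : Matrix (Fin d) (Fin d) ℝ} (hW : W.PosDef) :
    ∃ B : Matrix (Fin d) (Fin d) ℝ, IsUnit B ∧ W = Bᵀ * B := by
  obtain ⟨B, hB⟩ := posSemidef_iff_eq_transpose_mul_self.mp hW.posSemidef
  refine ⟨B, ?_, hB⟩
  have h := hW.isUnit
  rw [hB, isUnit_iff_isUnit_det, det_mul, IsUnit.mul_iff] at h
  exact (isUnit_iff_isUnit_det B).mpr h.2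

lemma posDef_mul_mul_transpose {d : ℕ} {S B : Matrix (Fin d) (Fin d) ℝ} (hS : S.PosDef)
    (hB : IsUnit B) : (B * S * Bᵀ).PosDef := by
  simpa using hS.mul_mul_conjTranspose_same
    (B := B) (by rwa [Matrix.vecMul_injective_iff_isUnit])

/-- The tangent inequality of the concave function `log det` at `W⁻¹`. -/
lemma log_det_add_log_det_le {d : ℕ} {S W : Matrix (Fin d) (Fin d) ℝ} (hS : S.PosDef)
    (hW : W.PosDef) : Real.log S.det + Real.log W.det ≤ (W * S).trace - d := by
  obtain ⟨B, hB, rfl⟩ := exists_isUnit_transpose_mul hW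
  have h := log_det_le_trace_sub (posDef_mul_mul_transpose hS hB)
  have h1 : (B * S * Bᵀ).det = S.det * (Bᵀ * B).det := by simp only [det_mul]; ring
  rw [h1, Real.log_mul hS.det_pos.ne' hW.det_pos.ne', trace_mul_comm, ← mul_assoc] at h
  exact h

lemma mul_eq_one_of_log_det_eq {d : ℕ} {S W : Matrix (Fin d) (Fin d) ℝ} (hS : S.PosDef)
    (hW : W.PosDef) (h : (W * S).trace - d ≤ Real.log S.det + Real.log W.det) : W * S = 1 := by
  obtain ⟨B, hB, rfl⟩ := exists_isUnit_transpose_mul hW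
  have h1 : (B * S * Bᵀ).det = S.det * (Bᵀ * B).det := by simp only [det_mul]; ring
  have h2 : B * S * Bᵀ = 1 := by
    refine eq_one_of_log_det_eq (posDef_mul_mul_transpose hS hB) ?_
    rw [h1, Real.log_mul hS.det_pos.ne' hW.det_pos.ne', trace_mul_comm, ← mul_assoc]
    exact h
  have h3 : Bᵀ * (B * S) = 1 := mul_eq_one_comm.mp h2
  rw [mul_assoc, h3]

/-! ### Existence and uniqueness of Graphical Lasso solutions -/

lemma normOneOff_eq {d : ℕ} (M : Matrix (Fin d) (Fin d) ℝ) :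
    normOneOff M = ∑ i, ∑ j, if i = j then 0 else |M i j| := by
  unfold normOneOff
  rw [← Finset.sum_sub_distrib]
  refine Finset.sum_congr rfl fun i _ => ?_
  have : |M i i| = ∑ j, if i = j then |M i j| else 0 := by simp
  rw [this, ← Finset.sum_sub_distrib]
  refine Finset.sum_congr rfl fun j _ => ?_
  split_ifs <;> simp

lemma trace_mul_eq_sum {d : ℕ} {C S : Matrix (Fin d) (Fin d) ℝ} (hS : S.IsSymm) :
    (C * S).trace = ∑ i, ∑ j, C i j * S i j := by
  simp only [trace, Matrix.diag_apply, Matrix.mul_apply]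
  refine Finset.sum_congr rfl fun i _ => Finset.sum_congr rfl fun j _ => ?_
  rw [hS.apply]

lemma trace_mul_add_eq_sum {d : ℕ} {C S : Matrix (Fin d) (Fin d) ℝ} (lam : ℝ) (hS : S.IsSymm) :
    (C * S).trace + lam * normOneOff S =
      ∑ i, ∑ j, (C i j * S i j + if i = j then 0 else lam * |S i j|) := by
  rw [trace_mul_eq_sum hS, normOneOff_eq, Finset.mul_sum, ← Finset.sum_add_distrib]
  refine Finset.sum_congr rfl fun i _ => ?_
  rw [Finset.mul_sum, ← Finset.sum_add_distrib]
  refine Finset.sum_congr rfl fun j _ => ?_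
  split_ifs <;> simp

/-- If `|W - C| ≤ lam` off the diagonal and `W = C` on it, then `trace (W S)` minorizes the linear
and the `1`-norm part of the objective. -/
lemma trace_mul_le_of_abs_sub_le {d : ℕ} {C S W : Matrix (Fin d) (Fin d) ℝ} {lam : ℝ}
    (hS : S.IsSymm) (hd : ∀ i, W i i = C i i) (ho : ∀ i j, i ≠ j → |W i j - C i j| ≤ lam) :
    (W * S).trace ≤ (C * S).trace + lam * normOneOff S := by
  rw [trace_mul_add_eq_sum lam hS, trace_mul_eq_sum hS]
  refine Finset.sum_le_sum fun i _ => Finset.sum_le_sum fun j _ => ?_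
  split_ifs with h
  · rw [h, hd]; simp
  · have h1 := le_abs_self ((W i j - C i j) * S i j)
    rw [abs_mul] at h1
    have := mul_le_mul_of_nonneg_right (ho i j h) (abs_nonneg (S i j))
    linarith

lemma isSymm_of_posDef {d : ℕ} {S : Matrix (Fin d) (Fin d) ℝ} (hS : S.PosDef) : S.IsSymm := by
  have := hS.1
  simpa [Matrix.IsHermitian, Matrix.IsSymm] using this

/-- The optimality conditions of the Graphical Lasso are sufficient, and they determine the
solution: `W = A⁻¹` agrees with `C` on the diagonal and `W - C` is `lam` times a subgradient of the
off-diagonal `1`-norm at `A`. -/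
theorem isSolution_iff_of_kkt {d : ℕ} {C A W : Matrix (Fin d) (Fin d) ℝ} {lam : ℝ}
    (hA : A.PosDef) (hW : W.PosDef) (hWA : W * A = 1) (hd : ∀ i, W i i = C i i)
    (ho : ∀ i j, i ≠ j → |W i j - C i j| ≤ lam)
    (hs : ∀ i j, i ≠ j → (W i j - C i j) * A i j = lam * |A i j|)
    (S : Matrix (Fin d) (Fin d) ℝ) : IsSolution C lam S ↔ S = A := by
  have hlog : Real.log A.det = - Real.log W.det := by
    have h1 : W.det * A.det = 1 := by rw [← det_mul, hWA, det_one]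
    have h2 := Real.log_mul hW.det_pos.ne' hA.det_pos.ne'
    rw [h1, Real.log_one] at h2
    linarith
  have htr : (C * A).trace + lam * normOneOff A = d := by
    have : (W * A).trace = (C * A).trace + lam * normOneOff A := by
      rw [trace_mul_add_eq_sum lam (isSymm_of_posDef hA), trace_mul_eq_sum (isSymm_of_posDef hA)]
      refine Finset.sum_congr rfl fun i _ => Finset.sum_congr rfl fun j _ => ?_
      split_ifs with h
      · rw [h, hd]; simp
      · linarith [hs i j h]
    rw [← this, hWA]; simp
  have hobjA : objective C lam A = Real.log W.det + d := by
    unfold objective; linarith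
  have hobj : ∀ S : Matrix (Fin d) (Fin d) ℝ, S.PosDef →
      (W * S).trace - Real.log S.det ≤ objective C lam S := by
    intro S hS
    have := trace_mul_le_of_abs_sub_le (lam := lam) (isSymm_of_posDef hS) hd ho
    unfold objective; linarith
  have hmin : IsSolution C lam A := by
    refine ⟨hA, fun S hS => ?_⟩
    linarith [hobj S hS, log_det_add_log_det_le hS hW]
  refine ⟨fun h => ?_, fun h => h ▸ hmin⟩
  have h1 := h.2 A hA
  have h2 := mul_eq_one_of_log_det_eq h.1 hW (by linarith [hobj S h.1])
  calc S = (A * W) * S := by rw [mul_eq_one_comm.mp hWA, one_mul]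
    _ = A := by rw [mul_assoc, h2, mul_one]

/-- The Graphical Lasso objective is strictly convex, so it has at most one minimizer. -/
theorem IsSolution.unique {d : ℕ} {C S T : Matrix (Fin d) (Fin d) ℝ} {lam : ℝ} (hlam : 0 ≤ lam)
    (hS : IsSolution C lam S) (hT : IsSolution C lam T) : S = T := by
  set M : Matrix (Fin d) (Fin d) ℝ := (1 / 2 : ℝ) • (S + T) with hMdef
  have hM : M.PosDef := (hS.1.add hT.1).smul (by norm_num)
  have hW := hM.inv
  have hMu : IsUnit M.det := hM.det_pos.ne'.isUnit
  have hlog : Real.log M⁻¹.det = - Real.log M.det := by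
    rw [det_nonsing_inv, Ring.inverse_eq_inv', Real.log_inv]
  have h1 := log_det_add_log_det_le hS.1 hW
  have h2 := log_det_add_log_det_le hT.1 hW
  have htr : (M⁻¹ * S).trace + (M⁻¹ * T).trace = 2 * d := by
    rw [← trace_add, ← mul_add]
    have : S + T = (2 : ℝ) • M := by rw [hMdef, smul_smul]; norm_num
    rw [this, mul_smul_comm, nonsing_inv_mul _ hMu]
    simp
  have hlin : (C * M).trace = ((C * S).trace + (C * T).trace) / 2 := by
    rw [hMdef, mul_smul_comm, mul_add, trace_smul, trace_add, smul_eq_mul]; ring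
  have hone : normOneOff M ≤ (normOneOff S + normOneOff T) / 2 := by
    simp only [normOneOff_eq]
    rw [← Finset.sum_add_distrib, Finset.sum_div]
    refine Finset.sum_le_sum fun i _ => ?_
    rw [← Finset.sum_add_distrib, Finset.sum_div]
    refine Finset.sum_le_sum fun j _ => ?_
    split_ifs
    · simp
    · rw [hMdef, Matrix.smul_apply, Matrix.add_apply, smul_eq_mul, abs_mul,
        abs_of_pos (by norm_num)]
      linarith [abs_add_le (S i j) (T i j)]
  have h3 := hS.2 M hM
  have h4 := hT.2 M hM
  have hone' := mul_le_mul_of_nonneg_left hone hlam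
  unfold objective at h3 h4
  have e1 : M⁻¹ * S = 1 := mul_eq_one_of_log_det_eq hS.1 hW (by linarith)
  have e2 : M⁻¹ * T = 1 := mul_eq_one_of_log_det_eq hT.1 hW (by linarith)
  rw [← one_mul S, ← one_mul T, ← mul_nonsing_inv M hMu, mul_assoc, mul_assoc, e1, e2]

lemma abs_apply_le_of_posSemidef {d : ℕ} {S : Matrix (Fin d) (Fin d) ℝ} (hS : S.PosSemidef)
    (i j : Fin d) : |S i j| ≤ (S i i + S j j) / 2 := by
  have h1 := hS.dotProduct_mulVec_nonneg (Pi.single i 1 + Pi.single j 1)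
  have h2 := hS.dotProduct_mulVec_nonneg (Pi.single i 1 - Pi.single j 1)
  have h3 : S j i = S i j := by simpa using hS.1.apply i j
  simp [mulVec_add, mulVec_sub, add_dotProduct, sub_dotProduct, h3] at h1 h2
  rw [abs_le]
  constructor <;> linarith

lemma apply_self_le_trace {d : ℕ} {S : Matrix (Fin d) (Fin d) ℝ} (hS : S.PosSemidef)
    (i : Fin d) : S i i ≤ S.trace :=
  Finset.single_le_sum (f := fun i => S i i) (fun _ _ => hS.diag_nonneg) (mem_univ i)

lemma abs_apply_le_trace {d : ℕ} {S : Matrix (Fin d) (Fin d) ℝ} (hS : S.PosSemidef)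
    (i j : Fin d) : |S i j| ≤ S.trace := by
  linarith [abs_apply_le_of_posSemidef hS i j, apply_self_le_trace hS i, apply_self_le_trace hS j]

lemma trace_mul_nonneg {d : ℕ} {C S : Matrix (Fin d) (Fin d) ℝ} (hC : C.PosSemidef)
    (hS : S.PosSemidef) : 0 ≤ (C * S).trace := by
  obtain ⟨B, rfl⟩ := posSemidef_iff_eq_transpose_mul_self.mp hC
  have := (hS.mul_mul_conjTranspose_same B).trace_nonneg
  rw [trace_mul_comm, ← mul_assoc] at this
  exact this

lemma exists_pos_le_diag {d : ℕ} (hd : 0 < d) {C : Matrix (Fin d) (Fin d) ℝ}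
    (hdiag : ∀ i, 0 < C i i) : ∃ m, 0 < m ∧ ∀ i, m ≤ C i i := by
  have : Nonempty (Fin d) := ⟨⟨0, hd⟩⟩
  obtain ⟨i, -, hi⟩ := Finset.exists_min_image univ (fun i => C i i) univ_nonempty
  exact ⟨C i i, hdiag i, fun j => hi j (mem_univ j)⟩

/-- The linear and `1`-norm part of the objective dominates a multiple of the trace: the matrix `W`
obtained from `C` by shrinking the off-diagonal entries a little is a convex combination of `C`
and its diagonal. -/
lemma exists_mul_trace_le {d : ℕ} (hd : 0 < d) {C : Matrix (Fin d) (Fin d) ℝ}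
    (hC : C.PosSemidef) (hdiag : ∀ i, 0 < C i i) {lam : ℝ} (hlam : 0 < lam) :
    ∃ c, 0 < c ∧ ∀ S : Matrix (Fin d) (Fin d) ℝ, S.PosSemidef →
      c * S.trace ≤ (C * S).trace + lam * normOneOff S := by
  obtain ⟨m, hm, hmC⟩ := exists_pos_le_diag hd hdiag
  have hT : 0 ≤ C.trace := hC.trace_nonneg
  set θ : ℝ := lam / (lam + C.trace) with hθ
  have hθ0 : 0 < θ := by positivity
  have hθ1 : θ ≤ 1 := by rw [hθ, div_le_one (by positivity)]; linarith
  have hθC : θ * C.trace ≤ lam := by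
    rw [hθ, div_mul_eq_mul_div, div_le_iff₀ (by positivity)]
    nlinarith
  refine ⟨θ * m, by positivity, fun S hS => ?_⟩
  have hsymm : S.IsSymm := by simpa [Matrix.IsHermitian, Matrix.IsSymm] using hS.1
  set W : Matrix (Fin d) (Fin d) ℝ := (1 - θ) • C + θ • diagonal (fun i => C i i) with hW
  have h1 : (W * S).trace ≤ (C * S).trace + lam * normOneOff S := by
    refine trace_mul_le_of_abs_sub_le hsymm (fun i => ?_) (fun i j hij => ?_)
    · simp [hW]; ring
    · have : W i j - C i j = - (θ * C i j) := by simp [hW, hij]; ring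
      rw [this, abs_neg, abs_mul, abs_of_pos hθ0]
      exact (mul_le_mul_of_nonneg_left (abs_apply_le_trace hC i j) hθ0.le).trans hθC
  refine le_trans ?_ h1
  have h2 : (W * S).trace = (1 - θ) * (C * S).trace + θ * ∑ i, C i i * S i i := by
    rw [hW, add_mul, trace_add, smul_mul_assoc, smul_mul_assoc, trace_smul, trace_smul]
    simp [trace, diagonal_mul]
  have h3 : m * S.trace ≤ ∑ i, C i i * S i i := by
    rw [trace, Finset.mul_sum]
    exact Finset.sum_le_sum fun i _ => mul_le_mul_of_nonneg_right (hmC i) hS.diag_nonneg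
  have h4 := mul_nonneg (sub_nonneg.mpr hθ1) (trace_mul_nonneg hC hS)
  rw [h2]
  nlinarith [mul_le_mul_of_nonneg_left h3 hθ0.le]

lemma isCompact_posSemidef_trace_le {d : ℕ} (T δ : ℝ) :
    IsCompact {S : Matrix (Fin d) (Fin d) ℝ | S.PosSemidef ∧ S.trace ≤ T ∧ δ ≤ S.det} := by
  have hc : IsCompact (Set.pi Set.univ fun _ : Fin d => Set.pi Set.univ fun _ : Fin d =>
      Set.Icc (-T) T) := isCompact_univ_pi fun _ => isCompact_univ_pi fun _ => isCompact_Icc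
  refine IsCompact.of_isClosed_subset hc ?_ ?_
  · have h1 : IsClosed {S : Matrix (Fin d) (Fin d) ℝ | S.PosSemidef} := by
      simp only [posSemidef_iff_dotProduct_mulVec, Matrix.IsHermitian, Set.ofPred_and,
        Set.ofPred_forall]
      refine IsClosed.inter (isClosed_eq (by fun_prop) continuous_id)
        (isClosed_iInter fun x => isClosed_le continuous_const (by fun_prop))
    exact h1.inter ((isClosed_le continuous_id.matrix_trace continuous_const).inter
      (isClosed_le continuous_const continuous_id.matrix_det))
  · rintro S ⟨hS, hT, -⟩ i - j -
    exact abs_le.mp ((abs_apply_le_trace hS i j).trans hT)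

/-- By coercivity the Graphical Lasso with a positive semidefinite input with positive diagonal
has a solution. -/
theorem exists_isSolution {d : ℕ} (hd : 0 < d) {C : Matrix (Fin d) (Fin d) ℝ}
    (hC : C.PosSemidef) (hdiag : ∀ i, 0 < C i i) {lam : ℝ} (hlam : 0 < lam) :
    ∃ S, IsSolution C lam S := by
  obtain ⟨c, hc, hcS⟩ := exists_mul_trace_le hd hC hdiag hlam
  set b := objective C lam 1 with hb
  set T := (b - d - d * Real.log (c / 2)) / (c / 2) with hT
  set K := {S : Matrix (Fin d) (Fin d) ℝ | S.PosSemidef ∧ S.trace ≤ T ∧ Real.exp (-b) ≤ S.det}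
    with hK
  have hKpos : ∀ S ∈ K, S.PosDef := fun S hS =>
    hS.1.posDef_iff_det_ne_zero.mpr ((Real.exp_pos _).trans_le hS.2.2).ne'
  -- The sublevel set of the objective at the identity matrix lies in `K`.
  have hsub : ∀ S : Matrix (Fin d) (Fin d) ℝ, S.PosDef → objective C lam S ≤ b → S ∈ K := by
    intro S hS hSb
    have h1 := hcS S hS.posSemidef
    have h2 : Real.log S.det + Real.log (diagonal (fun _ : Fin d => c / 2)).det ≤ _ :=
      log_det_add_log_det_le hS (PosDef.diagonal fun _ => by positivity)
    have h3 : (diagonal (fun _ : Fin d => c / 2) * S).trace = c / 2 * S.trace := by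
      simp [trace, diagonal_mul, Finset.mul_sum]
    rw [h3, det_diagonal, Finset.prod_const, Real.log_pow, card_univ, Fintype.card_fin] at h2
    unfold objective at hSb
    refine ⟨hS.posSemidef, ?_, ?_⟩
    · rw [hT, le_div_iff₀ (by positivity)]
      linarith
    · rw [← Real.exp_log hS.det_pos]
      refine Real.exp_le_exp.mpr ?_
      have := mul_nonneg hc.le hS.posSemidef.trace_nonneg
      linarith
  have h1K : (1 : Matrix (Fin d) (Fin d) ℝ) ∈ K := hsub 1 PosDef.one le_rfl
  have hcont : ContinuousOn (objective C lam) K := by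
    unfold objective normOneOff
    refine ContinuousOn.add (ContinuousOn.add (ContinuousOn.neg (ContinuousOn.log ?_ ?_)) ?_) ?_
    · fun_prop
    · exact fun S hS => (hKpos S hS).det_pos.ne'
    · fun_prop
    · fun_prop
  obtain ⟨S, hS, hmin⟩ := (isCompact_posSemidef_trace_le T (Real.exp (-b))).exists_isMinOn
    ⟨1, h1K⟩ hcont
  refine ⟨S, hKpos S hS, fun S' hS' => ?_⟩
  rcases le_total (objective C lam S') b with h | h
  · exact hmin (hsub S' hS' h)
  · exact (hmin h1K).trans h

/-! ### Non-backtracking walks, cycles and simple paths -/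

/-- A non-backtracking walk that revisits a vertex contains a cycle that is no longer than the
walk itself. -/
lemma isPath_or_exists_isCycle {V : Type*} {G : SimpleGraph V} {v w : V} (p : G.Walk v w)
    (h : List.IsChain (· ≠ ·) p.edges) :
    p.IsPath ∨ ∃ (a : V) (c : G.Walk a a), c.IsCycle ∧ c.length ≤ p.length := by
  classical
  induction p with
  | nil => simp
  | @cons u' v' _ head tail ih =>
    have hcc := List.isChain_cons.mp (SimpleGraph.Walk.edges_cons _ _ ▸ h)
    rcases ih hcc.2 with hp | ⟨a, c, hc, hl⟩
    swap
    · exact .inr ⟨a, c, hc, hl.trans (by simp)⟩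
    by_cases hu : u' ∈ tail.support
    swap
    · exact .inl ((SimpleGraph.Walk.cons_isPath_iff head tail).mpr ⟨hp, hu⟩)
    refine .inr ⟨u', .cons head (tail.takeUntil u' hu), ?_, ?_⟩
    · refine (SimpleGraph.Walk.cons_isCycle_iff _ _).mpr ⟨hp.takeUntil hu, fun he => ?_⟩
      have hlen : 0 < tail.length := by
        rcases Nat.eq_zero_or_pos tail.length with h0 | h0
        · rw [SimpleGraph.Walk.nil_iff_support_eq.mp (SimpleGraph.Walk.length_eq_zero_iff.mp h0)]
            at hu
          exact absurd (List.mem_singleton.mp hu) head.ne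
        · exact h0
      -- A path can meet its starting point only in its first edge, which would be a backtrack.
      refine hcc.1 s(u', v') ?_ rfl
      rw [← tail.cons_tail_eq (by simp [SimpleGraph.Walk.not_nil_iff_lt_length, hlen])]
      have := (hp.takeUntil hu).eq_snd_of_mem_edges (Sym2.eq_swap ▸ he)
      simp [this, SimpleGraph.Walk.snd_takeUntil head.ne]
    · simpa using tail.length_takeUntil_le_length hu

lemma exists_isCycle_of_isChain_closed {V : Type*} {G : SimpleGraph V} {v w : V} (h : G.Adj v w)
    (p : G.Walk w v) (hp : List.IsChain (· ≠ ·) (SimpleGraph.Walk.cons h p).edges) :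
    ∃ (a : V) (c : G.Walk a a), c.IsCycle ∧ c.length ≤ p.length + 1 := by
  rcases isPath_or_exists_isCycle _ hp with h1 | h1
  · simp at h1
  · simpa using h1

/-- `WalkFree G k a b j`: every non-backtracking walk of `G` that starts with the step `a → b` and
ends at `j` has more than `k` edges. -/
def WalkFree {V : Type*} (G : SimpleGraph V) (k : ℕ) (a b j : V) : Prop :=
  ∀ (h : G.Adj a b) (p : G.Walk b j),
    List.IsChain (· ≠ ·) (SimpleGraph.Walk.cons h p).edges → k < p.length + 1

lemma WalkFree.ne {V : Type*} {G : SimpleGraph V} {k : ℕ} {a b j : V}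
    (hf : WalkFree G (k + 1) a b j) (h : G.Adj a b) : b ≠ j := by
  rintro rfl
  simpa using hf h .nil (by simp)

lemma WalkFree.step {V : Type*} {G : SimpleGraph V} {k : ℕ} {a b c j : V}
    (hf : WalkFree G (k + 1) a b j) (h : G.Adj a b) (hc : c ≠ a) : WalkFree G k b c j := by
  intro h' q hq
  have := hf h (.cons h' q) (by
    rw [SimpleGraph.Walk.edges_cons, SimpleGraph.Walk.edges_cons] at *
    refine List.isChain_cons_cons.mpr ⟨?_, hq⟩
    rw [Ne, Sym2.eq_iff]
    rintro (⟨h1, -⟩ | ⟨h1, -⟩)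
    · exact h.ne h1
    · exact hc h1.symm)
  simp at this
  omega

lemma walkFree_closed {V : Type*} {G : SimpleGraph V} {k : ℕ}
    (hk : ∀ (a : V) (c : G.Walk a a), c.IsCycle → k < c.length) (j c : V) :
    WalkFree G k j c j := by
  intro h p hp
  obtain ⟨a, c, hc, hl⟩ := exists_isCycle_of_isChain_closed h p hp
  exact (hk a c hc).trans_le hl

lemma walkFree_of_adj {V : Type*} {G : SimpleGraph V} {k : ℕ}
    (hk : ∀ (a : V) (c : G.Walk a a), c.IsCycle → k + 1 < c.length) {i j c : V} (h : G.Adj i j)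
    (hc : c ≠ j) : WalkFree G k i c j :=
  (walkFree_closed hk j i).step h.symm hc

lemma girth_le_card {d : ℕ} {G : SimpleGraph (Fin d)} (hG : ¬ G.IsAcyclic) : G.girth ≤ d := by
  obtain ⟨a, w, hw, h⟩ := SimpleGraph.exists_girth_eq_length.mpr hG
  have := hw.isPath_tail.length_lt
  rw [Fintype.card_fin] at this
  have := SimpleGraph.Walk.length_tail_add_one hw.not_nil
  omega

lemma card_path_le_pMax {d : ℕ} (G : SimpleGraph (Fin d)) (i j : Fin d) :
    Nat.card (G.Path i j) ≤ pMax G :=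
  Finset.le_sup (f := fun p : Fin d × Fin d => Nat.card (G.Path p.1 p.2)) (mem_univ (i, j))

lemma two_le_pMax {d : ℕ} {G : SimpleGraph (Fin d)} (hG : ¬ G.IsAcyclic) : 2 ≤ pMax G := by
  classical
  rw [SimpleGraph.isAcyclic_iff_subsingleton_path] at hG
  push Not at hG
  obtain ⟨v, w, hvw⟩ := hG
  obtain ⟨p, q, hpq⟩ := hvw
  refine le_trans ?_ (card_path_le_pMax G v w)
  rw [Nat.card_eq_fintype_card]
  exact Fintype.one_lt_card_iff.mpr ⟨p, q, hpq⟩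

lemma two_le_maxDeg {d : ℕ} {G : SimpleGraph (Fin d)} (hG : ¬ G.IsAcyclic) : 2 ≤ maxDeg G := by
  classical
  obtain ⟨a, w, hw, -⟩ := SimpleGraph.exists_girth_eq_length.mpr hG
  have h1 : ({w.snd, w.penultimate} : Finset (Fin d)) ⊆ G.neighborFinset a := by
    intro x hx
    rw [SimpleGraph.mem_neighborFinset]
    rcases Finset.mem_insert.mp hx with rfl | hx
    · exact w.adj_snd hw.not_nil
    · rw [Finset.mem_singleton.mp hx]
      exact (w.adj_penultimate hw.not_nil).symm
  have h2 := Finset.card_le_card h1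
  rw [Finset.card_pair hw.snd_ne_penultimate, SimpleGraph.card_neighborFinset_eq_degree] at h2
  unfold maxDeg
  convert h2.trans (G.degree_le_maxDegree a)

/-- An edge and the two-step detours through common neighbours are distinct simple paths. -/
lemma card_common_neighbors_lt_pMax {d : ℕ} {G : SimpleGraph (Fin d)} {i j : Fin d}
    (h : G.Adj i j) (s : Finset (Fin d)) (hs : ∀ c ∈ s, G.Adj i c ∧ G.Adj c j) :
    #s + 1 ≤ pMax G := by
  classical
  refine le_trans ?_ (card_path_le_pMax G i j)
  let f : Option s → G.Path i j := fun o => match o with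
    | none => ⟨.cons h .nil, by simp [h.ne]⟩
    | some c => ⟨.cons (hs c c.2).1 (.cons (hs c c.2).2 .nil), by
        simp [h.ne, (hs c c.2).1.ne, (hs c c.2).2.ne]⟩
  have hf : Function.Injective f := by
    rintro (_ | ⟨a, ha⟩) (_ | ⟨b, hb⟩) hab
    · rfl
    · exact absurd (congrArg (fun p : G.Path i j => p.1.length) hab) (by simp [f])
    · exact absurd (congrArg (fun p : G.Path i j => p.1.length) hab) (by simp [f])
    · simp [f] at hab
      simp [hab]
  have := Nat.card_le_card_of_injective f hf
  rw [Nat.card_eq_fintype_card] at this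
  simpa using this

section Bethe

/-! ### The Bethe matrix and its inverse -/

/-- The normalized form of the closed-form matrix: `closedForm` is obtained from `bethe` of the
normalized residue by rescaling with the diagonal of `Sig`. Since `r` vanishes off the edges, the
sum over all `m` is a sum over neighbours. -/
def bethe {d : ℕ} (r : Matrix (Fin d) (Fin d) ℝ) : Matrix (Fin d) (Fin d) ℝ :=
  Matrix.of fun i j =>
    if i = j then 1 + ∑ m, r i m ^ 2 / (1 - r i m ^ 2) else -r i j / (1 - r i j ^ 2)

/-- The message on the directed edge `a → b`. If `v` is the `j`-th column of `(bethe r)⁻¹`, this is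
the total weight of the non-backtracking walks that start with the step `a → b` and end at `j`. -/
def dart {d : ℕ} (r : Matrix (Fin d) (Fin d) ℝ) (v : Fin d → ℝ) (a b : Fin d) : ℝ :=
  (r a b * v b - r a b ^ 2 * v a) / (1 - r a b ^ 2)

/-- `r` is symmetric with zero diagonal and entries of size at most `α`, where `8 d α ≤ 1`. -/
structure IsSmall {d : ℕ} (r : Matrix (Fin d) (Fin d) ℝ) (α : ℝ) : Prop where
  symm : ∀ i j, r j i = r i j
  diag : ∀ i, r i i = 0
  nonneg : 0 ≤ α
  abs_le : ∀ i j, |r i j| ≤ α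
  small : 8 * (d * α) ≤ 1

variable {d : ℕ} {r : Matrix (Fin d) (Fin d) ℝ} {α : ℝ}

lemma IsSmall.le (h : IsSmall r α) (hd : 0 < d) : 8 * α ≤ 1 := by
  have h1 : (1 : ℝ) ≤ d := by exact_mod_cast hd
  nlinarith [h.small, h.nonneg]

lemma IsSmall.sq_le (h : IsSmall r α) (i j : Fin d) : r i j ^ 2 ≤ 1 / 64 := by
  have h1 := h.le i.pos
  have h2 := h.abs_le i j
  rw [← sq_abs]
  nlinarith [abs_nonneg (r i j)]

lemma bethe_mulVec (h : IsSmall r α) (v : Fin d → ℝ) (i : Fin d) :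
    (bethe r *ᵥ v) i = v i - ∑ j, dart r v i j := by
  have h1 : ∀ j, bethe r i j * v j = (if i = j then v i + ∑ m, r i m ^ 2 / (1 - r i m ^ 2) * v i
      else 0) - r i j / (1 - r i j ^ 2) * v j := by
    intro j
    unfold bethe
    rw [of_apply]
    split_ifs with hij
    · subst hij
      rw [h.diag i, add_mul, Finset.sum_mul]; simp
    · ring
  simp only [mulVec, dotProduct, h1, Finset.sum_sub_distrib, Finset.sum_ite_eq, mem_univ, if_true]
  rw [add_sub_assoc, ← Finset.sum_sub_distrib, sub_eq_add_neg, ← Finset.sum_neg_distrib]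
  congr 1
  refine Finset.sum_congr rfl fun j _ => ?_
  unfold dart
  ring

lemma half_sum_sq_le_bethe (h : IsSmall r α) (v : Fin d → ℝ) :
    1 / 2 * ∑ i, v i ^ 2 ≤ v ⬝ᵥ bethe r *ᵥ v := by
  have h1 : ∀ i j, v i * dart r v i j ≤ α * v i ^ 2 + α * v j ^ 2 := by
    intro i j
    have hsq := h.sq_le i j
    have hpos : 0 < 1 - r i j ^ 2 := by linarith
    unfold dart
    rw [mul_div_assoc', div_le_iff₀ hpos]
    have e1 : r i j * (v i * v j) ≤ α * ((v i ^ 2 + v j ^ 2) / 2) := by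
      refine (le_abs_self _).trans ?_
      rw [abs_mul]
      refine mul_le_mul (h.abs_le i j) ?_ (abs_nonneg _) h.nonneg
      rw [_root_.abs_le]
      constructor <;> nlinarith [sq_nonneg (v i + v j), sq_nonneg (v i - v j)]
    have e2 : 0 ≤ α * (v i ^ 2 + v j ^ 2) := mul_nonneg h.nonneg (by positivity)
    have e3 : 0 ≤ r i j ^ 2 * v i ^ 2 := by positivity
    nlinarith
  have h2 : ∑ i, ∑ j, v i * dart r v i j ≤ 2 * (d * α) * ∑ i, v i ^ 2 := by
    calc _ ≤ ∑ i, ∑ j, (α * v i ^ 2 + α * v j ^ 2) :=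
          Finset.sum_le_sum fun i _ => Finset.sum_le_sum fun j _ => h1 i j
      _ = _ := by
          simp only [Finset.sum_add_distrib, ← Finset.mul_sum, sum_const, card_univ,
            Fintype.card_fin, nsmul_eq_mul]
          ring
  have h3 : v ⬝ᵥ bethe r *ᵥ v = ∑ i, v i ^ 2 - ∑ i, ∑ j, v i * dart r v i j := by
    simp only [dotProduct, bethe_mulVec h, mul_sub, Finset.sum_sub_distrib, Finset.mul_sum, pow_two]
  have h4 : 0 ≤ ∑ i, v i ^ 2 := Finset.sum_nonneg fun i _ => sq_nonneg _
  rw [h3]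
  nlinarith [h.small]

lemma posDef_bethe (h : IsSmall r α) : (bethe r).PosDef := by
  refine PosDef.of_dotProduct_mulVec_pos ?_ fun v hv => ?_
  · ext i j
    simp only [bethe, conjTranspose_apply, of_apply, star_trivial]
    by_cases hij : i = j
    · subst hij; rfl
    · rw [if_neg hij, if_neg (Ne.symm hij), h.symm]
  · rw [star_trivial]
    refine lt_of_lt_of_le ?_ (half_sum_sq_le_bethe h v)
    obtain ⟨i, hi⟩ := Function.ne_iff.mp hv
    have : 0 < ∑ i, v i ^ 2 :=
      Finset.sum_pos' (fun i _ => sq_nonneg _) ⟨i, mem_univ i, sq_pos_iff.mpr (by simpa using hi)⟩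
    linarith

variable {v : Fin d → ℝ} {j : Fin d}

lemma bethe_mulVec_inv_col (h : IsSmall r α) (j : Fin d) :
    bethe r *ᵥ (fun i => (bethe r)⁻¹ i j) = Pi.single j 1 := by
  have h1 : bethe r * (bethe r)⁻¹ = 1 := mul_nonsing_inv _ (posDef_bethe h).det_pos.ne'.isUnit
  ext i
  have h2 := congrFun (congrFun h1 i) j
  rw [Matrix.mul_apply] at h2
  simp only [mulVec, dotProduct]
  rw [h2, Matrix.one_apply, Pi.single_apply]

lemma abs_apply_le_two (h : IsSmall r α) (hv : bethe r *ᵥ v = Pi.single j 1) (i : Fin d) :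
    |v i| ≤ 2 := by
  have h1 := half_sum_sq_le_bethe h v
  rw [hv, dotProduct_single, mul_one] at h1
  have h2 : ∀ i, v i ^ 2 ≤ ∑ i, v i ^ 2 := fun i =>
    Finset.single_le_sum (f := fun i => v i ^ 2) (fun i _ => sq_nonneg _) (mem_univ i)
  have h3 : v j ≤ 2 := by nlinarith [h2 j]
  refine abs_le_of_sq_le_sq ?_ (by norm_num)
  nlinarith [h2 i]

lemma apply_eq_add_sum_dart (h : IsSmall r α) (hv : bethe r *ᵥ v = Pi.single j 1) (i : Fin d) :
    v i = (if i = j then 1 else 0) + ∑ c, dart r v i c := by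
  have h1 := bethe_mulVec h v i
  rw [hv, Pi.single_apply] at h1
  linarith

/-- The messages satisfy the recursion for the weights of non-backtracking walks: a walk that
starts with `a → b` either stops at `b = j` or continues with `b → c` for some `c ≠ a`. -/
lemma dart_eq (h : IsSmall r α) (hv : bethe r *ᵥ v = Pi.single j 1) (a b : Fin d) :
    dart r v a b = r a b * ((if b = j then 1 else 0) + ∑ c ∈ univ.erase a, dart r v b c) := by
  have h1 := apply_eq_add_sum_dart h hv b
  rw [← Finset.add_sum_erase _ _ (mem_univ a)] at h1
  have h2 : dart r v a b = r a b * (v b - dart r v b a) := by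
    have hsq := h.sq_le a b
    have hpos : 1 - r a b ^ 2 ≠ 0 := by linarith
    unfold dart
    rw [h.symm a b]
    field_simp
    ring
  rw [h2, h1]
  ring

lemma abs_dart_le (h : IsSmall r α) (hv : bethe r *ᵥ v = Pi.single j 1) (a b : Fin d) :
    |dart r v a b| ≤ 4 * α := by
  have hsq := h.sq_le a b
  have hpos : 0 < 1 - r a b ^ 2 := by linarith
  have h8 := h.le a.pos
  have hα := h.nonneg
  unfold dart
  rw [abs_div, abs_of_pos hpos, div_le_iff₀ hpos]
  have e1 : |r a b * v b - r a b ^ 2 * v a| ≤ |r a b| * |v b| + |r a b| ^ 2 * |v a| := by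
    refine (abs_sub _ _).trans ?_
    rw [abs_mul, abs_mul, abs_pow]
  have e2 : |r a b| * |v b| ≤ α * 2 :=
    mul_le_mul (h.abs_le a b) (abs_apply_le_two h hv b) (abs_nonneg _) hα
  have e3 : |r a b| ^ 2 * |v a| ≤ α ^ 2 * 2 :=
    mul_le_mul (pow_le_pow_left₀ (abs_nonneg _) (h.abs_le a b) 2) (abs_apply_le_two h hv a)
      (abs_nonneg _) (by positivity)
  nlinarith

lemma abs_sum_le_card_mul {s : Finset (Fin d)} {f : Fin d → ℝ} {B : ℝ} (hB : 0 ≤ B)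
    (hf : ∀ c ∈ s, |f c| ≤ B) : |∑ c ∈ s, f c| ≤ d * B := by
  refine (Finset.abs_sum_le_sum_abs _ _).trans ((Finset.sum_le_card_nsmul _ _ _ hf).trans ?_)
  rw [nsmul_eq_mul]
  refine mul_le_mul_of_nonneg_right ?_ hB
  exact_mod_cast (card_le_univ s).trans (by simp)

/-- Unrolling the recursion: a message is exponentially small in the length of the shortest
non-backtracking walk that contributes to it. -/
lemma abs_dart_le_of_walkFree (h : IsSmall r α) (hv : bethe r *ᵥ v = Pi.single j 1)
    {G : SimpleGraph (Fin d)} (hG : ∀ i j, r i j ≠ 0 → G.Adj i j) {k : ℕ} {a b : Fin d}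
    (hf : WalkFree G k a b j) : |dart r v a b| ≤ 4 * α * (d * α) ^ k := by
  have hα := h.nonneg
  induction k generalizing a b with
  | zero => simpa using abs_dart_le h hv a b
  | succ k ih =>
    rw [dart_eq h hv]
    by_cases hab : r a b = 0
    · rw [hab]; simp; positivity
    rw [if_neg (hf.ne (hG _ _ hab)), zero_add, abs_mul]
    calc _ ≤ α * (d * (4 * α * (d * α) ^ k)) := by
          refine mul_le_mul (h.abs_le a b) (abs_sum_le_card_mul (by positivity) fun c hc => ?_)
            (abs_nonneg _) hα
          exact ih (hf.step (hG _ _ hab) (Finset.ne_of_mem_erase hc))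
      _ = _ := by ring

/-! ### Entrywise estimates for the inverse of the Bethe matrix -/

lemma abs_apply_le_of_ne (h : IsSmall r α) (hv : bethe r *ᵥ v = Pi.single j 1) {i : Fin d}
    (hij : i ≠ j) : |v i| ≤ 4 * (d * α) := by
  rw [apply_eq_add_sum_dart h hv, if_neg hij, zero_add]
  have := abs_sum_le_card_mul (s := univ) (by linarith [h.nonneg]) fun c _ => abs_dart_le h hv i c
  linarith

lemma abs_apply_self_sub_one_le (h : IsSmall r α) (hv : bethe r *ᵥ v = Pi.single j 1)
    {G : SimpleGraph (Fin d)} (hG : ∀ i j, r i j ≠ 0 → G.Adj i j) {k : ℕ}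
    (hk : ∀ (a : Fin d) (c : G.Walk a a), c.IsCycle → k < c.length) :
    |v j - 1| ≤ 4 * (d * α) ^ (k + 1) := by
  have hα := h.nonneg
  rw [apply_eq_add_sum_dart h hv, if_pos rfl, add_sub_cancel_left]
  refine (abs_sum_le_card_mul (by positivity) fun c _ =>
    abs_dart_le_of_walkFree h hv hG (walkFree_closed hk j c)).trans_eq ?_
  ring

lemma apply_sub_eq (h : IsSmall r α) (hv : bethe r *ᵥ v = Pi.single j 1) {i : Fin d}
    (hij : i ≠ j) : v i - r i j =
      r i j * ∑ c ∈ univ.erase i, dart r v j c + ∑ c ∈ univ.erase j, dart r v i c := by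
  rw [apply_eq_add_sum_dart h hv, if_neg hij, ← Finset.add_sum_erase _ _ (mem_univ j),
    dart_eq h hv i j, if_pos rfl]
  ring

lemma abs_mul_sum_dart_le (h : IsSmall r α) (hv : bethe r *ᵥ v = Pi.single j 1)
    {G : SimpleGraph (Fin d)} (hG : ∀ i j, r i j ≠ 0 → G.Adj i j) {k : ℕ}
    (hk : ∀ (a : Fin d) (c : G.Walk a a), c.IsCycle → k < c.length) (i : Fin d) :
    |r i j * ∑ c ∈ univ.erase i, dart r v j c| ≤ 4 * (d * α) ^ (k + 1) := by
  have hα := h.nonneg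
  rw [abs_mul]
  have h1 : |∑ c ∈ univ.erase i, dart r v j c| ≤ d * (4 * α * (d * α) ^ k) :=
    abs_sum_le_card_mul (by positivity) fun c _ =>
      abs_dart_le_of_walkFree h hv hG (walkFree_closed hk j c)
  have h2 : |r i j| ≤ 1 := (h.abs_le i j).trans (by linarith [h.le i.pos])
  calc _ ≤ 1 * (d * (4 * α * (d * α) ^ k)) := mul_le_mul h2 h1 (abs_nonneg _) zero_le_one
    _ = _ := by ring

lemma abs_apply_sub_le_of_adj (h : IsSmall r α) (hv : bethe r *ᵥ v = Pi.single j 1)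
    {G : SimpleGraph (Fin d)} (hG : ∀ i j, r i j ≠ 0 → G.Adj i j) {k : ℕ}
    (hk : ∀ (a : Fin d) (c : G.Walk a a), c.IsCycle → k + 1 < c.length) {i : Fin d}
    (hij : G.Adj i j) : |v i - r i j| ≤ 8 * (d * α) ^ (k + 1) := by
  have hα := h.nonneg
  rw [apply_sub_eq h hv hij.ne]
  refine (abs_add_le _ _).trans ?_
  have h1 := abs_mul_sum_dart_le h hv hG (fun a c hc => (Nat.lt_succ_self k).trans (hk a c hc)) i
  have h2 : |∑ c ∈ univ.erase j, dart r v i c| ≤ d * (4 * α * (d * α) ^ k) :=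
    abs_sum_le_card_mul (by positivity) fun c hc =>
      abs_dart_le_of_walkFree h hv hG (walkFree_of_adj hk hij (Finset.ne_of_mem_erase hc))
  have h3 : d * (4 * α * (d * α) ^ k) = 4 * (d * α) ^ (k + 1) := by ring
  linarith

/-- The leading error on an edge comes from its triangles, i.e. from the common neighbours of its
end points. -/
lemma abs_apply_sub_le_triangle (h : IsSmall r α) (hv : bethe r *ᵥ v = Pi.single j 1)
    {G : SimpleGraph (Fin d)} (hG : ∀ i j, r i j ≠ 0 → G.Adj i j) {i : Fin d}
    (hij : G.Adj i j) {N : ℕ}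
    (hN : ∀ s : Finset (Fin d), (∀ c ∈ s, G.Adj i c ∧ G.Adj c j) → #s ≤ N) :
    |v i - r i j| ≤ N * α ^ 2 + 8 * (d * α) ^ 3 := by
  have hα := h.nonneg
  have h1 := abs_mul_sum_dart_le (k := 2) h hv hG (fun a c hc => hc.three_le_length) i
  have h3 : ∀ c ∈ univ.erase j, |dart r v i c - r i c * r c j| ≤ 4 * d ^ 2 * α ^ 3 := by
    intro c hc
    have e1 : ∀ e, dart r v c e = (if e = j then r c e else 0) +
        r c e * ∑ f ∈ univ.erase c, dart r v e f := by
      intro e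
      rw [dart_eq h hv c e]
      split_ifs <;> ring
    have e2 : dart r v i c - r i c * r c j =
        r i c * ∑ e ∈ univ.erase i, r c e * ∑ f ∈ univ.erase c, dart r v e f := by
      rw [dart_eq h hv i c, if_neg (Finset.ne_of_mem_erase hc),
        Finset.sum_congr rfl fun e _ => e1 e, Finset.sum_add_distrib, Finset.sum_ite_eq',
        if_pos (Finset.mem_erase.mpr ⟨hij.ne', mem_univ j⟩)]
      ring
    rw [e2, abs_mul]
    calc _ ≤ α * (d * (α * (d * (4 * α)))) := by
          refine mul_le_mul (h.abs_le i c) (abs_sum_le_card_mul (by positivity) fun e _ => ?_)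
            (abs_nonneg _) hα
          rw [abs_mul]
          exact mul_le_mul (h.abs_le c e)
            (abs_sum_le_card_mul (by positivity) fun f _ => abs_dart_le h hv e f)
            (abs_nonneg _) hα
      _ = _ := by ring
  have h4 : |∑ c ∈ univ.erase j, (dart r v i c - r i c * r c j)| ≤ d * (4 * d ^ 2 * α ^ 3) :=
    abs_sum_le_card_mul (by positivity) h3
  have h5 : |∑ c ∈ univ.erase j, r i c * r c j| ≤ N * α ^ 2 := by
    have e1 : ∑ c ∈ univ.erase j, r i c * r c j =
        ∑ c ∈ (univ.erase j).filter (fun c => r i c * r c j ≠ 0), r i c * r c j :=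
      (Finset.sum_filter_ne_zero _).symm
    rw [e1]
    refine (Finset.abs_sum_le_sum_abs _ _).trans
      ((Finset.sum_le_card_nsmul _ _ (α ^ 2) fun c _ => ?_).trans ?_)
    · rw [abs_mul, pow_two]
      exact mul_le_mul (h.abs_le i c) (h.abs_le c j) (abs_nonneg _) hα
    · rw [nsmul_eq_mul]
      refine mul_le_mul_of_nonneg_right ?_ (by positivity)
      exact_mod_cast hN _ fun c hc => by
        have := mul_ne_zero_iff.mp (Finset.mem_filter.mp hc).2
        exact ⟨hG _ _ this.1, hG _ _ this.2⟩
  have h6 : ∑ c ∈ univ.erase j, dart r v i c = ∑ c ∈ univ.erase j, (dart r v i c - r i c * r c j) +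
      ∑ c ∈ univ.erase j, r i c * r c j := by
    rw [← Finset.sum_add_distrib]; simp
  rw [apply_sub_eq h hv hij.ne, h6]
  have h7 := abs_add_le (r i j * ∑ c ∈ univ.erase i, dart r v j c)
    (∑ c ∈ univ.erase j, (dart r v i c - r i c * r c j) + ∑ c ∈ univ.erase j, r i c * r c j)
  have h8 := abs_add_le (∑ c ∈ univ.erase j, (dart r v i c - r i c * r c j))
    (∑ c ∈ univ.erase j, r i c * r c j)
  have h9 : (d : ℝ) * (4 * d ^ 2 * α ^ 3) = 4 * (d * α) ^ 3 := by ring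
  rw [show 2 + 1 = 3 from rfl] at h1
  linarith

lemma eq_zero_of_forall_abs_le {x q C : ℝ} (hq0 : 0 ≤ q) (hq : q < 1)
    (h : ∀ k : ℕ, |x| ≤ C * q ^ (k + 1)) : x = 0 := by
  have h1 : Filter.Tendsto (fun k : ℕ => C * q ^ (k + 1)) Filter.atTop (nhds (C * 0)) :=
    ((tendsto_pow_atTop_nhds_zero_of_lt_one hq0 hq).comp (Filter.tendsto_add_atTop_nat 1)).const_mul
      C
  rw [mul_zero] at h1
  exact abs_nonpos_iff.mp (ge_of_tendsto' h1 h)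

lemma girthPow_nonneg {G : SimpleGraph (Fin d)} (hα : 0 ≤ α) : 0 ≤ girthPow G α := by
  unfold girthPow; split_ifs <;> positivity

/-- On the diagonal the Bethe approximation is exact up to a term of higher order than `girthPow`:
a closed non-backtracking walk is at least as long as the shortest cycle. -/
theorem abs_inv_diag_sub_one_le (h : IsSmall r α) (hv : bethe r *ᵥ v = Pi.single j 1)
    {G : SimpleGraph (Fin d)} (hG : ∀ i j, r i j ≠ 0 → G.Adj i j) :
    |v j - 1| ≤ 4 * d ^ d * α * (((pMax G : ℝ) - 1) * girthPow G α) := by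
  have hα := h.nonneg
  have hd : (1 : ℝ) ≤ d := by exact_mod_cast j.pos
  by_cases hac : G.IsAcyclic
  · have : v j - 1 = 0 := by
      refine eq_zero_of_forall_abs_le (q := d * α) (C := 4) (by positivity)
        (by linarith [h.small]) fun k =>
        abs_apply_self_sub_one_le h hv hG (k := k) fun a c hc => absurd hc (hac c)
    rw [this, girthPow, if_pos hac]; simp
  · have hg := SimpleGraph.three_le_girth hac
    have h1 := abs_apply_self_sub_one_le h hv hG (k := G.girth - 1) fun a c hc => by
      have := SimpleGraph.girth_le_length hc; omega
    rw [Nat.sub_add_cancel (by omega)] at h1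
    have hP : (1 : ℝ) ≤ (pMax G : ℝ) - 1 := by
      have : (2 : ℝ) ≤ pMax G := by exact_mod_cast two_le_pMax hac
      linarith
    have hα1 : α ≤ 1 := by linarith [h.le j.pos]
    rw [girthPow, if_neg hac]
    set e := ⌈(G.girth : ℝ) / 2⌉₊ with he
    have hel : e + 1 ≤ G.girth := by
      have : e ≤ G.girth - 1 := by
        rw [he, Nat.ceil_le, Nat.cast_sub (by omega)]
        have : (3 : ℝ) ≤ G.girth := by exact_mod_cast hg
        push_cast; linarith
      omega
    calc |v j - 1| ≤ 4 * (d * α) ^ G.girth := h1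
      _ = 4 * (d ^ G.girth * α ^ G.girth) := by rw [mul_pow]
      _ ≤ 4 * (d ^ d * α ^ (e + 1)) := by
          refine mul_le_mul_of_nonneg_left (mul_le_mul ?_ ?_ (by positivity) (by positivity))
            (by norm_num)
          · exact pow_le_pow_right₀ hd (girth_le_card hac)
          · exact pow_le_pow_of_le_one hα hα1 hel
      _ = 4 * d ^ d * α * (1 * α ^ e) := by ring
      _ ≤ _ := by gcongr

/-- On an edge the error of the Bethe approximation is governed by the shortest cycle: for girth
at least `4` it has order `girth - 1`, which exceeds `⌈girth / 2⌉`; for girth `3` the orders agree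
and the leading coefficient counts two-step paths. -/
theorem abs_inv_apply_sub_le (h : IsSmall r α) (hv : bethe r *ᵥ v = Pi.single j 1)
    {G : SimpleGraph (Fin d)} (hG : ∀ i j, r i j ≠ 0 → G.Adj i j)
    (hsmall : 8 * (d : ℝ) ^ (d + 3) * α ≤ 1) {i : Fin d} (hij : G.Adj i j) :
    |v i - r i j| ≤ 2 * (((pMax G : ℝ) - 1) * girthPow G α) := by
  have hα := h.nonneg
  have hd : (1 : ℝ) ≤ d := by exact_mod_cast j.pos
  by_cases hac : G.IsAcyclic
  · have : v i - r i j = 0 := by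
      refine eq_zero_of_forall_abs_le (q := d * α) (C := 8) (by positivity)
        (by linarith [h.small]) fun k =>
        abs_apply_sub_le_of_adj h hv hG (k := k) (fun a c hc => absurd hc (hac c)) hij
    rw [this, girthPow, if_pos hac]; simp
  have hg := SimpleGraph.three_le_girth hac
  have hP : (1 : ℝ) ≤ (pMax G : ℝ) - 1 := by
    have : (2 : ℝ) ≤ pMax G := by exact_mod_cast two_le_pMax hac
    linarith
  have hα1 : α ≤ 1 := by linarith [h.le j.pos]
  have hsm : ∀ m ≤ d + 3, 8 * (d : ℝ) ^ m * α ≤ 1 := fun m hm => by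
    refine le_trans ?_ hsmall
    gcongr
  rw [girthPow, if_neg hac]
  rcases Nat.eq_or_lt_of_le hg with h3 | h4
  · have he : ⌈(G.girth : ℝ) / 2⌉₊ = 2 := by
      rw [← h3, Nat.ceil_eq_iff (by norm_num)]; norm_num
    rw [he]
    have h1 := abs_apply_sub_le_triangle h hv hG hij (N := pMax G - 1) fun s hs => by
      have := card_common_neighbors_lt_pMax hij s hs; omega
    rw [Nat.cast_sub (by have := two_le_pMax hac; omega), Nat.cast_one] at h1
    have h2 : 8 * (d * α) ^ 3 ≤ 1 * α ^ 2 := by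
      calc 8 * (d * α) ^ 3 = (8 * (d : ℝ) ^ 3 * α) * α ^ 2 := by ring
        _ ≤ 1 * α ^ 2 := by gcongr; exact hsm 3 (by omega)
    have h5 : 1 * α ^ 2 ≤ ((pMax G : ℝ) - 1) * α ^ 2 := by gcongr
    linarith
  · set e := ⌈(G.girth : ℝ) / 2⌉₊ with he
    have hel : e + 1 ≤ G.girth - 1 := by
      have : e ≤ G.girth - 2 := by
        rw [he, Nat.ceil_le, Nat.cast_sub (by omega)]
        have : (4 : ℝ) ≤ G.girth := by exact_mod_cast h4
        push_cast; linarith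
      omega
    have h1 := abs_apply_sub_le_of_adj h hv hG (k := G.girth - 2) (fun a c hc => by
      have := SimpleGraph.girth_le_length hc; omega) hij
    rw [show G.girth - 2 + 1 = G.girth - 1 by omega] at h1
    calc |v i - r i j| ≤ 8 * (d * α) ^ (G.girth - 1) := h1
      _ = 8 * (d ^ (G.girth - 1) * α ^ (G.girth - 1)) := by rw [mul_pow]
      _ ≤ 8 * (d ^ (G.girth - 1) * α ^ (e + 1)) := by
          gcongr 8 * (_ * ?_)
          exact pow_le_pow_of_le_one hα hα1 hel
      _ = (8 * (d : ℝ) ^ (G.girth - 1) * α) * α ^ e := by ring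
      _ ≤ 1 * α ^ e := by
          gcongr
          exact hsm _ (by have := girth_le_card hac; omega)
      _ ≤ ((pMax G : ℝ) - 1) * α ^ e := by gcongr
      _ ≤ _ := by
          have : 0 ≤ ((pMax G : ℝ) - 1) * α ^ e := by positivity
          linarith

end Bethe

section ClosedForm

/-! ### The residue and the closed form -/

lemma abs_le_normMaxOff {d : ℕ} (M : Matrix (Fin d) (Fin d) ℝ) {i j : Fin d} (h : i ≠ j) :
    |M i j| ≤ normMaxOff M :=
  le_ciSup (f := fun p : {p : Fin d × Fin d // p.1 ≠ p.2} => |M p.1.1 p.1.2|)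
    (Set.finite_range _).bddAbove ⟨(i, j), h⟩

lemma normMaxOff_le {d : ℕ} {M : Matrix (Fin d) (Fin d) ℝ} {B : ℝ} (hB : 0 ≤ B)
    (h : ∀ i j, i ≠ j → |M i j| ≤ B) : normMaxOff M ≤ B :=
  Real.iSup_le (fun p => h _ _ p.2) hB

lemma normMaxOff_nonneg {d : ℕ} (M : Matrix (Fin d) (Fin d) ℝ) : 0 ≤ normMaxOff M :=
  Real.iSup_nonneg fun _ => abs_nonneg _

variable {d : ℕ} {Sig : Matrix (Fin d) (Fin d) ℝ} {lam : ℝ}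

lemma residue_self (i : Fin d) : residue Sig lam i i = 0 := by simp [residue]

lemma residue_of_le {i j : Fin d} (h : |Sig i j| ≤ lam) : residue Sig lam i j = 0 := by
  simp [residue, h]

lemma residue_of_lt {i j : Fin d} (hij : i ≠ j) (h : lam < |Sig i j|) :
    residue Sig lam i j = Sig i j - lam * Real.sign (Sig i j) := by
  simp [residue, hij, h]

lemma residue_symm (hs : ∀ i j, Sig j i = Sig i j) (i j : Fin d) :
    residue Sig lam j i = residue Sig lam i j := by
  simp only [residue, of_apply, hs i j, ne_comm]

lemma abs_sub_residue_le (hlam : 0 ≤ lam) {i j : Fin d} (hij : i ≠ j) :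
    |Sig i j - residue Sig lam i j| ≤ lam := by
  rcases le_or_gt |Sig i j| lam with h | h
  · simpa [residue_of_le h] using h
  · rw [residue_of_lt hij h, sub_sub_cancel, abs_mul, abs_of_nonneg hlam]
    rcases Real.sign_apply_eq (Sig i j) with h | h | h <;> simp [h, hlam]

lemma sign_mul_residue (hlam : 0 ≤ lam) (i j : Fin d) :
    Real.sign (Sig i j) * residue Sig lam i j = |residue Sig lam i j| := by
  by_cases hij : i = j
  · simp [hij, residue_self]
  rcases le_or_gt |Sig i j| lam with h | h
  · simp [residue_of_le h]
  rw [residue_of_lt hij h]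
  rcases lt_trichotomy (Sig i j) 0 with h0 | h0 | h0
  · rw [abs_of_neg h0] at h
    rw [Real.sign_of_neg h0, abs_of_neg (by linarith)]; ring
  · rw [h0, abs_zero] at h; linarith
  · rw [abs_of_pos h0] at h
    rw [Real.sign_of_pos h0, abs_of_pos (by linarith)]; ring

lemma abs_residue_le {B : ℝ} (hlam : 0 ≤ lam) (hB : 0 ≤ B) {i j : Fin d}
    (h : |Sig i j| ≤ lam + B) : |residue Sig lam i j| ≤ B := by
  by_cases hij : i = j
  · simpa [hij, residue_self] using hB
  rcases le_or_gt |Sig i j| lam with h1 | h1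
  · simpa [residue_of_le h1] using hB
  rw [← sign_mul_residue hlam, residue_of_lt hij h1]
  rcases lt_trichotomy (Sig i j) 0 with h0 | h0 | h0
  · rw [abs_of_neg h0] at h
    rw [Real.sign_of_neg h0]; linarith
  · rw [h0, abs_zero] at h1; linarith
  · rw [abs_of_pos h0] at h
    rw [Real.sign_of_pos h0]; linarith

lemma normResidue_apply (i j : Fin d) :
    normResidue Sig lam i j = residue Sig lam i j / (√(Sig i i) * √(Sig j j)) := by
  rw [normResidue, mul_diagonal, diagonal_mul]
  ring

lemma residue_eq (hdiag : ∀ i, 0 < Sig i i) (i j : Fin d) :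
    residue Sig lam i j = √(Sig i i) * √(Sig j j) * normResidue Sig lam i j := by
  have h1 := (Real.sqrt_pos.mpr (hdiag i)).ne'
  have h2 := (Real.sqrt_pos.mpr (hdiag j)).ne'
  rw [normResidue_apply]
  field_simp

lemma normResidue_ne_zero_iff (hdiag : ∀ i, 0 < Sig i i) (hs : ∀ i j, Sig j i = Sig i j)
    (i j : Fin d) : normResidue Sig lam i j ≠ 0 ↔ (supp (residue Sig lam)).Adj i j := by
  have h1 := (Real.sqrt_pos.mpr (hdiag i)).ne'
  have h2 := (Real.sqrt_pos.mpr (hdiag j)).ne'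
  have h3 : normResidue Sig lam i j ≠ 0 ↔ residue Sig lam i j ≠ 0 := by
    rw [normResidue_apply]
    simp [h1, h2]
  rw [h3, supp, SimpleGraph.fromRel_adj, residue_symm hs i j, or_self]
  refine ⟨fun h => ⟨?_, h⟩, fun h => h.2⟩
  rintro rfl
  exact h (residue_self i)

/-- Once it is small enough, the normalized residue satisfies the standing assumptions on the
weights of the Bethe matrix. -/
lemma isSmall_normResidue (hs : ∀ i j, Sig j i = Sig i j)
    (hα : 8 * (d * normMaxOff (normResidue Sig lam)) ≤ 1) :
    IsSmall (normResidue Sig lam) (normMaxOff (normResidue Sig lam)) where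
  symm i j := by rw [normResidue_apply, normResidue_apply, residue_symm hs, mul_comm]
  diag i := by rw [normResidue_apply, residue_self, zero_div]
  nonneg := normMaxOff_nonneg _
  abs_le i j := by
    by_cases hij : i = j
    · rw [hij, normResidue_apply, residue_self, zero_div, abs_zero]
      exact normMaxOff_nonneg _
    · exact abs_le_normMaxOff _ hij
  small := hα

lemma closedForm_apply_mul (hdiag : ∀ i, 0 < Sig i i) (hs : ∀ i j, Sig j i = Sig i j)
    (i j : Fin d) : √(Sig i i) * √(Sig j j) * closedForm Sig lam i j =
      bethe (normResidue Sig lam) i j := by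
  have hq : ∀ i, √(Sig i i) ^ 2 = Sig i i := fun i => Real.sq_sqrt (hdiag i).le
  have hden : ∀ i j, Sig i i * Sig j j - residue Sig lam i j ^ 2 =
      Sig i i * Sig j j * (1 - normResidue Sig lam i j ^ 2) := by
    intro i j
    rw [residue_eq hdiag, mul_pow, mul_pow, hq, hq]; ring
  unfold closedForm bethe
  simp only [of_apply]
  split_ifs with hij hadj
  · subst hij
    rw [← mul_assoc, ← pow_two, hq, mul_one_div_cancel (hdiag i).ne', one_mul]
    congr 1
    rw [Finset.sum_filter]
    refine Finset.sum_congr rfl fun m _ => ?_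
    split_ifs with h
    · rw [hden, residue_eq hdiag, mul_pow, mul_pow, hq, hq,
        mul_div_mul_left _ _ (mul_pos (hdiag i) (hdiag m)).ne']
    · rw [← normResidue_ne_zero_iff hdiag hs, not_not] at h
      simp [h]
  · rw [hden, mul_div_assoc', residue_eq hdiag, mul_neg, ← mul_assoc,
      show √(Sig i i) * √(Sig j j) * (√(Sig i i) * √(Sig j j)) =
      √(Sig i i) ^ 2 * √(Sig j j) ^ 2 by ring, hq, hq, ← mul_neg,
      mul_div_mul_left _ _ (mul_pos (hdiag i) (hdiag j)).ne']
  · rw [← normResidue_ne_zero_iff hdiag hs, not_not] at hadj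
    simp [hadj]

lemma closedForm_eq (hdiag : ∀ i, 0 < Sig i i) (hs : ∀ i j, Sig j i = Sig i j) :
    closedForm Sig lam = diagonal (fun i => (√(Sig i i))⁻¹) * bethe (normResidue Sig lam) *
      (diagonal (fun i => (√(Sig i i))⁻¹))ᵀ := by
  ext i j
  have h1 := (Real.sqrt_pos.mpr (hdiag i)).ne'
  have h2 := (Real.sqrt_pos.mpr (hdiag j)).ne'
  rw [diagonal_transpose, mul_diagonal, diagonal_mul, ← closedForm_apply_mul hdiag hs]
  field_simp

lemma isUnit_diagonal {s : Fin d → ℝ} (hs : ∀ i, 0 < s i) : IsUnit (diagonal s) :=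
  (PosDef.diagonal hs).isUnit

lemma posDef_closedForm (hdiag : ∀ i, 0 < Sig i i) (hs : ∀ i j, Sig j i = Sig i j) {α : ℝ}
    (h : IsSmall (normResidue Sig lam) α) : (closedForm Sig lam).PosDef := by
  rw [closedForm_eq hdiag hs]
  exact posDef_mul_mul_transpose (posDef_bethe h)
    (isUnit_diagonal fun i => inv_pos.mpr (Real.sqrt_pos.mpr (hdiag i)))

lemma closedForm_inv_apply (hdiag : ∀ i, 0 < Sig i i) (hs : ∀ i j, Sig j i = Sig i j) {α : ℝ}
    (h : IsSmall (normResidue Sig lam) α) (i j : Fin d) :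
    (closedForm Sig lam)⁻¹ i j =
      √(Sig i i) * √(Sig j j) * (bethe (normResidue Sig lam))⁻¹ i j := by
  have h1 : (diagonal fun i => √(Sig i i)) * diagonal (fun i => (√(Sig i i))⁻¹) = 1 := by
    rw [diagonal_mul_diagonal, ← diagonal_one]
    congr 1
    ext i
    exact mul_inv_cancel₀ (Real.sqrt_pos.mpr (hdiag i)).ne'
  have h2 : bethe (normResidue Sig lam) * (bethe (normResidue Sig lam))⁻¹ = 1 :=
    mul_nonsing_inv _ (posDef_bethe h).det_pos.ne'.isUnit
  have h3 : closedForm Sig lam * ((diagonal fun i => √(Sig i i)) *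
      (bethe (normResidue Sig lam))⁻¹ * diagonal fun i => √(Sig i i)) = 1 := by
    rw [closedForm_eq hdiag hs, diagonal_transpose]
    calc _ = diagonal (fun i => (√(Sig i i))⁻¹) * (bethe (normResidue Sig lam) *
          (diagonal (fun i => (√(Sig i i))⁻¹) * diagonal fun i => √(Sig i i)) *
          (bethe (normResidue Sig lam))⁻¹) * diagonal fun i => √(Sig i i) := by
            simp only [mul_assoc]
      _ = 1 := by
        rw [mul_eq_one_comm.mp h1, mul_one, h2, mul_one, mul_eq_one_comm.mp h1]
  rw [inv_eq_right_inv h3, mul_diagonal, diagonal_mul]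
  ring

lemma supp_closedForm_adj (hdiag : ∀ i, 0 < Sig i i) (hs : ∀ i j, Sig j i = Sig i j) {α : ℝ}
    (h : IsSmall (normResidue Sig lam) α) {i j : Fin d}
    (hij : (supp (residue Sig lam)).Adj i j) : (supp (closedForm Sig lam)).Adj i j := by
  rw [supp, SimpleGraph.fromRel_adj]
  refine ⟨hij.ne, .inl fun h0 => ?_⟩
  have h1 := closedForm_apply_mul (lam := lam) hdiag hs i j
  have h2 := (normResidue_ne_zero_iff hdiag hs i j).mpr hij
  have h3 := h.sq_le i j
  rw [h0, mul_zero, bethe, of_apply, if_neg hij.ne, eq_comm, div_eq_zero_iff, neg_eq_zero] at h1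
  rcases h1 with h1 | h1
  · exact h2 h1
  · linarith

/-! ### Spectral bounds -/

/-- Schur's test. -/
lemma normTwo_le_of_row_sum_le {M : Matrix (Fin d) (Fin d) ℝ} (hM : ∀ i j, M j i = M i j)
    {ρ : ℝ} (hρ : 0 ≤ ρ) (h : ∀ i, ∑ j, |M i j| ≤ ρ) : normTwo M ≤ ρ := by
  unfold normTwo
  refine ContinuousLinearMap.opNorm_le_bound _ hρ fun x => ?_
  rw [EuclideanSpace.norm_eq, EuclideanSpace.norm_eq, ← Real.sqrt_sq hρ,
    ← Real.sqrt_mul (by positivity)]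
  refine Real.sqrt_le_sqrt ?_
  have h1 : ∀ i, ‖(toEuclideanCLM (n := Fin d) (𝕜 := ℝ) M x) i‖ ^ 2 ≤
      ρ * ∑ j, |M i j| * x j ^ 2 := by
    intro i
    have e1 : (toEuclideanCLM (n := Fin d) (𝕜 := ℝ) M x) i = ∑ j, M i j * x j := rfl
    rw [e1, Real.norm_eq_abs, sq_abs]
    have e2 := Finset.sum_sq_le_sum_mul_sum_of_sq_le_mul univ
      (r := fun j => M i j * x j) (f := fun j => |M i j|) (g := fun j => |M i j| * x j ^ 2)
      (fun j _ => abs_nonneg _) (fun j _ => by positivity) (fun j _ => by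
        rw [mul_pow, ← sq_abs (M i j)]; exact le_of_eq (by ring))
    exact e2.trans (mul_le_mul_of_nonneg_right (h i) (Finset.sum_nonneg fun j _ => by positivity))
  calc _ ≤ ∑ i, ρ * ∑ j, |M i j| * x j ^ 2 := Finset.sum_le_sum fun i _ => h1 i
    _ = ρ * ∑ j, (∑ i, |M j i|) * x j ^ 2 := by
        rw [← Finset.mul_sum, Finset.sum_comm]
        simp only [Finset.sum_mul, hM]
    _ ≤ ρ * ∑ j, ρ * x j ^ 2 := by
        gcongr with j
        exact h j
    _ = _ := by
        rw [← Finset.mul_sum]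
        simp only [Real.norm_eq_abs, sq_abs]
        ring

/-- A row of a matrix supported on the edges and the diagonal lives in one component. -/
lemma sum_abs_le_dMax_mul {A M : Matrix (Fin d) (Fin d) ℝ} {B : ℝ} (hB : ∀ i j, |M i j| ≤ B)
    (hM : ∀ i j, M i j ≠ 0 → i = j ∨ (supp A).Adj i j) (i : Fin d) :
    ∑ j, |M i j| ≤ dMax A * B := by
  have hB0 : 0 ≤ B := (abs_nonneg _).trans (hB i i)
  have h1 : #(univ.filter fun j => |M i j| ≠ 0) ≤ dMax A := by
    have e1 : ((supp A).connectedComponentMk i).supp.ncard ≤ dMax A :=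
      le_ciSup (f := fun c : (supp A).ConnectedComponent => c.supp.ncard)
        (Set.finite_range _).bddAbove _
    refine le_trans ?_ e1
    rw [← Set.ncard_coe_finset]
    refine Set.ncard_le_ncard (fun j hj => ?_) (Set.toFinite _)
    rw [SimpleGraph.ConnectedComponent.mem_supp_iff, SimpleGraph.ConnectedComponent.eq]
    rcases hM i j (by simpa using hj) with rfl | h
    · exact SimpleGraph.Reachable.refl _
    · exact h.symm.reachable
  rw [← Finset.sum_filter_ne_zero]
  refine (Finset.sum_le_card_nsmul _ _ B fun j _ => hB i j).trans ?_
  rw [nsmul_eq_mul]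
  exact mul_le_mul_of_nonneg_right (by exact_mod_cast h1) hB0

lemma one_le_dMax (hd : 0 < d) (A : Matrix (Fin d) (Fin d) ℝ) : 1 ≤ dMax A := by
  have e1 : ((supp A).connectedComponentMk ⟨0, hd⟩).supp.ncard ≤ dMax A :=
    le_ciSup (f := fun c : (supp A).ConnectedComponent => c.supp.ncard)
      (Set.finite_range _).bddAbove _
  refine le_trans ?_ e1
  rw [Nat.one_le_iff_ne_zero, Ne, Set.ncard_eq_zero, ← Ne, ← Set.nonempty_iff_ne_empty]
  exact SimpleGraph.ConnectedComponent.nonempty_supp _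

lemma nonneg_of_mem_spectrum {S : Matrix (Fin d) (Fin d) ℝ} (hS : S.PosDef) {x : ℝ}
    (hx : x ∈ spectrum ℝ S) : 0 ≤ x := by
  rw [hS.1.spectrum_real_eq_range_eigenvalues] at hx
  obtain ⟨i, rfl⟩ := hx
  exact (hS.eigenvalues_pos i).le

lemma muMin_nonneg {S : Matrix (Fin d) (Fin d) ℝ} (hS : S.PosDef) : 0 ≤ muMin S :=
  Real.sInf_nonneg fun _ hx => nonneg_of_mem_spectrum hS hx

lemma muMax_nonneg {S : Matrix (Fin d) (Fin d) ℝ} (hS : S.PosDef) : 0 ≤ muMax S :=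
  Real.sSup_nonneg fun _ hx => nonneg_of_mem_spectrum hS hx

lemma trace_le_mul_muMax {S : Matrix (Fin d) (Fin d) ℝ} (hS : S.PosDef) :
    S.trace ≤ d * muMax S := by
  rw [hS.1.trace_eq_sum_eigenvalues]
  simp only [RCLike.ofReal_real_eq_id, id]
  refine (Finset.sum_le_card_nsmul _ _ (muMax S) fun i _ => ?_).trans_eq (by simp)
  unfold muMax
  rw [hS.1.spectrum_real_eq_range_eigenvalues]
  exact le_csSup (Set.finite_range _).bddAbove ⟨i, rfl⟩

/-! ### Off-diagonal entries of near-optimal matrices -/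

lemma trace_le_four_mul {N : Matrix (Fin d) (Fin d) ℝ} (hN : N.PosDef) {β : ℝ}
    (hβ : 8 * β ≤ 1) (h : (1 - β) * N.trace ≤ d + Real.log N.det) : N.trace ≤ 4 * d := by
  have h1 := log_det_add_log_det_le hN (PosDef.diagonal (d := fun _ : Fin d => (2 : ℝ)⁻¹)
    fun _ => by norm_num)
  have h2 : (diagonal (fun _ : Fin d => (2 : ℝ)⁻¹) * N).trace = 2⁻¹ * N.trace := by
    simp [trace, diagonal_mul, Finset.mul_sum]
  rw [h2, det_diagonal, Finset.prod_const, Real.log_pow, card_univ, Fintype.card_fin,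
    Real.log_inv] at h1
  have h3 : Real.log 2 ≤ 1 := by linarith [Real.log_le_sub_one_of_pos (x := 2) (by norm_num)]
  have h4 : (d : ℝ) * Real.log 2 ≤ d * 1 := by gcongr
  nlinarith [hN.posSemidef.trace_nonneg]

lemma log_det_le_transvection {N : Matrix (Fin d) (Fin d) ℝ} (hN : N.PosDef) {i j : Fin d}
    (hij : i ≠ j) (c : ℝ) :
    Real.log N.det ≤ N.trace + 2 * c * N i j + c ^ 2 * N j j - d := by
  have hdet : (transvection i j c).det = 1 := det_transvection_of_ne i j hij c
  have h1 := log_det_le_trace_sub (posDef_mul_mul_transpose hN (B := transvection i j c)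
    ((isUnit_iff_isUnit_det _).mpr (by rw [hdet]; exact isUnit_one)))
  have hs : N j i = N i j := (isSymm_of_posDef hN).apply i j
  have h2 : (transvection i j c * N * (transvection i j c)ᵀ).trace =
      N.trace + 2 * c * N i j + c ^ 2 * N j j := by
    simp only [transvection, transpose_add, transpose_one, transpose_single, mul_add, add_mul,
      one_mul, mul_one, trace_add, trace_single_mul, trace_mul_single, mul_assoc]
    simp [hs]
    ring
  rw [det_mul, det_mul, det_transpose, hdet, h2] at h1
  simpa using h1

/-- A matrix that nearly maximizes `log det N - trace N` has small off-diagonal entries: compare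
it with its images under transvections, which preserve the determinant. -/
lemma two_mul_abs_apply_le {N : Matrix (Fin d) (Fin d) ℝ} (hN : N.PosDef) {β τ : ℝ}
    (hβ0 : 0 ≤ β) (hβ : 8 * β ≤ 1) (hτ : 0 < τ)
    (h : (1 - β) * N.trace ≤ d + Real.log N.det) {i j : Fin d} (hij : i ≠ j) :
    2 * τ * |N i j| ≤ 4 * d * β + 4 * d * τ ^ 2 := by
  have hT := trace_le_four_mul hN hβ h
  have h1 := log_det_le_transvection hN hij τ
  have h2 := log_det_le_transvection hN hij (-τ)
  have h3 := apply_self_le_trace hN.posSemidef j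
  have h4 : τ ^ 2 * N j j ≤ τ ^ 2 * (4 * d) := by gcongr; linarith
  have h5 : β * N.trace ≤ β * (4 * d) := by gcongr
  rcases abs_cases (N i j) with ⟨h6, -⟩ | ⟨h6, -⟩ <;> rw [h6] <;> nlinarith

end ClosedForm

section Perturbation

variable {d : ℕ} {Sig : Matrix (Fin d) (Fin d) ℝ} {lam : ℝ}

/-! ### The perturbed input -/

open Classical in
/-- The input for which `closedForm Sig lam` satisfies the optimality conditions. It agrees with
`Sig` on the pairs that are neither diagonal nor edges of the thresholded graph; there the
optimality conditions are inequalities, with room for the entries of the inverse. -/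
def perturbedInput {d : ℕ} (Sig : Matrix (Fin d) (Fin d) ℝ) (lam : ℝ) :
    Matrix (Fin d) (Fin d) ℝ :=
  Matrix.of fun i j =>
    if i = j then (closedForm Sig lam)⁻¹ i j
    else if (supp (residue Sig lam)).Adj i j then
      (closedForm Sig lam)⁻¹ i j + lam * Real.sign (Sig i j)
    else Sig i j

/-- `lam` is close to the largest off-diagonal entry of `Sig`, or above it: the normalized residue
is tiny, and the entries of `Sig` below the threshold leave room for the entries of the inverse of
the closed form. The power `d ^ (d + 7)` covers all error terms at once: the girth contributes at
most `d ^ d`, and the remaining factors come from summing over rows and columns. -/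
structure IsLarge {d : ℕ} (Sig : Matrix (Fin d) (Fin d) ℝ) (lam : ℝ) : Prop where
  pos : 0 < lam
  small : 64 * (d : ℝ) ^ (d + 7) * normMaxOff (normResidue Sig lam) ≤ 1
  gap : ∀ i j, |Sig i j| ≤ lam → |Sig i j| +
    √(Sig i i) * √(Sig j j) * (4 * (d * normMaxOff (normResidue Sig lam))) ≤ lam

lemma IsLarge.pow_le (h : IsLarge Sig lam) (hd : 0 < d) {m : ℕ} (hm : m ≤ d + 7) {c : ℝ}
    (hc : c ≤ 64) : c * (d : ℝ) ^ m * normMaxOff (normResidue Sig lam) ≤ 1 := by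
  have h1 : (1 : ℝ) ≤ d := by exact_mod_cast hd
  have h2 := normMaxOff_nonneg (normResidue Sig lam)
  refine le_trans ?_ h.small
  gcongr

lemma IsLarge.isSmall (h : IsLarge Sig lam) (hs : ∀ i j, Sig j i = Sig i j) (hd : 0 < d) :
    IsSmall (normResidue Sig lam) (normMaxOff (normResidue Sig lam)) := by
  refine isSmall_normResidue hs ?_
  have := h.pow_le hd (m := 1) (by omega) (c := 8) (by norm_num)
  linarith

lemma perturbedInput_isSymm (hdiag : ∀ i, 0 < Sig i i) (hs : ∀ i j, Sig j i = Sig i j) {α : ℝ}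
    (h : IsSmall (normResidue Sig lam) α) : (perturbedInput Sig lam).IsSymm := by
  have h1 : ∀ i j, (closedForm Sig lam)⁻¹ j i = (closedForm Sig lam)⁻¹ i j := fun i j =>
    (isSymm_of_posDef (posDef_closedForm hdiag hs h).inv).apply i j
  ext i j
  by_cases hij : i = j
  · rw [hij, transpose_apply]
  by_cases hadj : (supp (residue Sig lam)).Adj i j
  · simp [perturbedInput, h1 i j, hs i j, hij, Ne.symm hij, hadj, hadj.symm]
  · have hadj' : ¬ (supp (residue Sig lam)).Adj j i := fun h => hadj h.symm
    simp [perturbedInput, hs i j, hij, Ne.symm hij, hadj, hadj']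

theorem isSolution_perturbedInput (hdiag : ∀ i, 0 < Sig i i) (hs : ∀ i j, Sig j i = Sig i j)
    (h : IsLarge Sig lam) (hd : 0 < d) (S : Matrix (Fin d) (Fin d) ℝ) :
    IsSolution (perturbedInput Sig lam) lam S ↔ S = closedForm Sig lam := by
  have hsm := h.isSmall hs hd
  have hA := posDef_closedForm hdiag hs hsm
  refine isSolution_iff_of_kkt hA hA.inv (nonsing_inv_mul _ hA.det_pos.ne'.isUnit) (fun i => ?_)
    (fun i j hij => ?_) (fun i j hij => ?_) S
  · simp [perturbedInput]
  · rw [perturbedInput, of_apply, if_neg hij]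
    split_ifs with hadj
    · rw [sub_add_cancel_left, abs_neg, abs_mul, abs_of_pos h.pos]
      rcases Real.sign_apply_eq (Sig i j) with h | h | h <;> simp [h, ‹IsLarge Sig lam›.pos.le]
    · have hle : |Sig i j| ≤ lam := by
        by_contra hlt
        refine hadj ((normResidue_ne_zero_iff hdiag hs i j).mp fun h0 => ?_)
        have h1 := residue_eq (lam := lam) hdiag i j
        have h2 := sign_mul_residue (Sig := Sig) h.pos.le i j
        rw [h0, mul_zero] at h1
        rw [residue_of_lt hij (not_le.mp hlt)] at h1
        rcases Real.sign_apply_eq (Sig i j) with h3 | h3 | h3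
        · rw [h3] at h1
          rw [show Sig i j = -lam by linarith, abs_neg, abs_of_pos h.pos] at hlt
          exact hlt le_rfl
        · rw [h3] at h1
          rw [show Sig i j = 0 by linarith, abs_zero] at hlt
          exact hlt h.pos.le
        · rw [h3] at h1
          rw [show Sig i j = lam by linarith, abs_of_pos h.pos] at hlt
          exact hlt le_rfl
      have h1 : |(closedForm Sig lam)⁻¹ i j| ≤ √(Sig i i) * √(Sig j j) *
          (4 * (d * normMaxOff (normResidue Sig lam))) := by
        rw [closedForm_inv_apply hdiag hs hsm, abs_mul, abs_of_nonneg (by positivity)]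
        exact mul_le_mul_of_nonneg_left
          (abs_apply_le_of_ne hsm (bethe_mulVec_inv_col hsm j) hij) (by positivity)
      have h2 := abs_sub ((closedForm Sig lam)⁻¹ i j) (Sig i j)
      linarith [h.gap i j hle]
  · rw [perturbedInput, of_apply, if_neg hij]
    split_ifs with hadj
    · have hpos : 0 < √(Sig i i) * √(Sig j j) :=
        mul_pos (Real.sqrt_pos.mpr (hdiag i)) (Real.sqrt_pos.mpr (hdiag j))
      have hden : 0 < Sig i i * Sig j j - residue Sig lam i j ^ 2 := by
        rw [residue_eq hdiag, mul_pow, mul_pow, Real.sq_sqrt (hdiag i).le,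
          Real.sq_sqrt (hdiag j).le]
        have := mul_pos (hdiag i) (hdiag j)
        nlinarith [hsm.sq_le i j]
      rw [closedForm, of_apply, if_neg hij, if_pos hadj, abs_div, abs_neg, abs_of_pos hden,
        ← sign_mul_residue h.pos.le]
      ring
    · simp [closedForm, hij, hadj]

/-! ### Size of the perturbation -/

/-- The common factor `(P_max - 1) α ^ ⌈c / 2⌉` of all error bounds. -/
def cycleError {d : ℕ} (Sig : Matrix (Fin d) (Fin d) ℝ) (lam : ℝ) : ℝ :=
  ((pMax (supp (residue Sig lam)) : ℝ) - 1) *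
    girthPow (supp (residue Sig lam)) (normMaxOff (normResidue Sig lam))

lemma cycleError_nonneg : 0 ≤ cycleError Sig lam := by
  unfold cycleError
  by_cases hac : (supp (residue Sig lam)).IsAcyclic
  · simp [girthPow, hac]
  · have : (2 : ℝ) ≤ pMax (supp (residue Sig lam)) := by exact_mod_cast two_le_pMax hac
    exact mul_nonneg (by linarith) (girthPow_nonneg (normMaxOff_nonneg _))

lemma le_iSup_diag (i : Fin d) : Sig i i ≤ ⨆ i, Sig i i :=
  le_ciSup (f := fun i => Sig i i) (Set.finite_range _).bddAbove i

lemma sqrt_mul_sqrt_le (hdiag : ∀ i, 0 < Sig i i) (i j : Fin d) :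
    √(Sig i i) * √(Sig j j) ≤ ⨆ i, Sig i i := by
  calc _ ≤ √(⨆ i, Sig i i) * √(⨆ i, Sig i i) := by
        gcongr <;> exact le_iSup_diag _
    _ = _ := Real.mul_self_sqrt ((hdiag i).le.trans (le_iSup_diag i))

/-- A cycle forces two neighbours at some vertex, hence `δ ≥ 2`. -/
lemma two_mul_cycleError_le_eps (hd : 0 < d) (hdiag : ∀ i, 0 < Sig i i)
    (h : normMaxOff (normResidue Sig lam) < 1) :
    (⨆ i, Sig i i) * (2 * cycleError Sig lam) ≤ eps Sig lam := by
  have h0 := normMaxOff_nonneg (normResidue Sig lam)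
  have hce := cycleError_nonneg (Sig := Sig) (lam := lam)
  have heps : eps Sig lam = max (⨆ i, Sig i i) (√((⨆ i, Sig i i) / (⨅ i, Sig i i))) *
      (delta Sig lam * cycleError Sig lam) := by
    unfold eps cycleError; ring
  rw [heps]
  have hS : 0 ≤ ⨆ i, Sig i i := (hdiag ⟨0, hd⟩).le.trans (le_iSup_diag _)
  have hδ : 2 * cycleError Sig lam ≤ delta Sig lam * cycleError Sig lam := by
    by_cases hac : (supp (residue Sig lam)).IsAcyclic
    · simp [cycleError, girthPow, hac]
    · refine mul_le_mul_of_nonneg_right ?_ hce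
      have hm : (2 : ℝ) ≤ maxDeg (supp (residue Sig lam)) := by
        exact_mod_cast two_le_maxDeg hac
      unfold delta
      set a := normMaxOff (normResidue Sig lam)
      have hpos : 0 < 1 - a ^ 2 := by nlinarith
      have e1 : 0 ≤ (maxDeg (supp (residue Sig lam)) : ℝ) * a ^ 2 / (1 - a ^ 2) := by positivity
      have e2 : 1 ≤ ((maxDeg (supp (residue Sig lam)) : ℝ) - 1) / (1 - a ^ 2) := by
        rw [le_div_iff₀ hpos]
        nlinarith [sq_nonneg a]
      linarith
  exact mul_le_mul (le_max_left _ _) hδ (by positivity) (hS.trans (le_max_left _ _))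

lemma sub_perturbedInput_of_ne (i j : Fin d) (hij : i ≠ j)
    (hadj : ¬ (supp (residue Sig lam)).Adj i j) : (Sig - perturbedInput Sig lam) i j = 0 := by
  simp [perturbedInput, hij, hadj]

lemma abs_sub_perturbedInput_self_le (hdiag : ∀ i, 0 < Sig i i) (hs : ∀ i j, Sig j i = Sig i j)
    (h : IsLarge Sig lam) (i : Fin d) :
    |(Sig - perturbedInput Sig lam) i i| ≤ √(Sig i i) * √(Sig i i) *
      (4 * d ^ d * normMaxOff (normResidue Sig lam) * cycleError Sig lam) := by
  have hsm := h.isSmall hs i.pos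
  have h1 := abs_inv_diag_sub_one_le hsm (bethe_mulVec_inv_col hsm i)
    fun i j => (normResidue_ne_zero_iff hdiag hs i j).mp
  have h2 : (Sig - perturbedInput Sig lam) i i =
      -(√(Sig i i) * √(Sig i i) * ((bethe (normResidue Sig lam))⁻¹ i i - 1)) := by
    rw [Matrix.sub_apply, perturbedInput, of_apply, if_pos rfl, closedForm_inv_apply hdiag hs hsm]
    have := Real.mul_self_sqrt (hdiag i).le
    linear_combination -this
  rw [h2, abs_neg, abs_mul, abs_of_nonneg (by positivity)]
  exact mul_le_mul_of_nonneg_left h1 (by positivity)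

lemma abs_sub_perturbedInput_le (hdiag : ∀ i, 0 < Sig i i) (hs : ∀ i j, Sig j i = Sig i j)
    (h : IsLarge Sig lam) (i j : Fin d) :
    |(Sig - perturbedInput Sig lam) i j| ≤ √(Sig i i) * √(Sig j j) *
      (2 * cycleError Sig lam) := by
  have hsm := h.isSmall hs i.pos
  have hce := cycleError_nonneg (Sig := Sig) (lam := lam)
  by_cases hij : i = j
  · subst hij
    refine (abs_sub_perturbedInput_self_le hdiag hs h i).trans ?_
    gcongr
    exact (h.pow_le i.pos (by omega) (by norm_num)).trans (by norm_num)
  by_cases hadj : (supp (residue Sig lam)).Adj i j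
  · have h1 := abs_inv_apply_sub_le hsm (bethe_mulVec_inv_col hsm j)
      (fun i j => (normResidue_ne_zero_iff hdiag hs i j).mp)
      (h.pow_le i.pos (by omega) (by norm_num)) hadj
    have hlt : lam < |Sig i j| := by
      by_contra hle
      have h0 := (normResidue_ne_zero_iff hdiag hs i j).mpr hadj
      rw [normResidue_apply, residue_of_le (not_lt.mp hle), zero_div] at h0
      exact h0 rfl
    have h2 : (Sig - perturbedInput Sig lam) i j = -(√(Sig i i) * √(Sig j j) *
        ((bethe (normResidue Sig lam))⁻¹ i j - normResidue Sig lam i j)) := by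
      rw [Matrix.sub_apply, perturbedInput, of_apply, if_neg hij, if_pos hadj,
        closedForm_inv_apply hdiag hs hsm, mul_sub, ← residue_eq hdiag, residue_of_lt hij hlt]
      ring
    rw [h2, abs_neg, abs_mul, abs_of_nonneg (by positivity)]
    exact mul_le_mul_of_nonneg_left h1 (by positivity)
  · rw [sub_perturbedInput_of_ne i j hij hadj, abs_zero]
    positivity

theorem normTwo_sub_perturbedInput_le (hdiag : ∀ i, 0 < Sig i i)
    (hs : ∀ i j, Sig j i = Sig i j) (h : IsLarge Sig lam) (hd : 0 < d) :
    normTwo (Sig - perturbedInput Sig lam) ≤ dMax (closedForm Sig lam) * eps Sig lam := by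
  have hsm := h.isSmall hs hd
  have hce := cycleError_nonneg (Sig := Sig) (lam := lam)
  have heps := two_mul_cycleError_le_eps (lam := lam) hd hdiag (by linarith [hsm.le hd])
  have hS : 0 ≤ ⨆ i, Sig i i := (hdiag ⟨0, hd⟩).le.trans (le_iSup_diag _)
  have heps0 : 0 ≤ eps Sig lam := le_trans (by positivity) heps
  refine normTwo_le_of_row_sum_le (fun i j => ?_) (by positivity)
    (sum_abs_le_dMax_mul (fun i j => ?_) (fun i j hij => ?_))
  · rw [Matrix.sub_apply, Matrix.sub_apply, hs, (perturbedInput_isSymm hdiag hs hsm).apply]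
  · refine (abs_sub_perturbedInput_le hdiag hs h i j).trans (le_trans ?_ heps)
    exact mul_le_mul_of_nonneg_right (sqrt_mul_sqrt_le hdiag i j) (by positivity)
  · by_contra hcon
    push Not at hcon
    exact hij (sub_perturbedInput_of_ne i j hcon.1 fun hadj =>
      hcon.2 (supp_closedForm_adj hdiag hs hsm hadj))

/-! ### The optimal value -/

/-- The rescaling `D^{1/2} S D^{1/2}` by the diagonal `D` of `Sig`. -/
def rescale {d : ℕ} (Sig S : Matrix (Fin d) (Fin d) ℝ) : Matrix (Fin d) (Fin d) ℝ :=
  diagonal (fun i => √(Sig i i)) * S * (diagonal fun i => √(Sig i i))ᵀ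

lemma rescale_apply (Sig S : Matrix (Fin d) (Fin d) ℝ) (i j : Fin d) :
    rescale Sig S i j = √(Sig i i) * √(Sig j j) * S i j := by
  rw [rescale, diagonal_transpose, mul_diagonal, diagonal_mul]; ring

lemma posDef_rescale (hdiag : ∀ i, 0 < Sig i i) {S : Matrix (Fin d) (Fin d) ℝ} (hS : S.PosDef) :
    (rescale Sig S).PosDef :=
  posDef_mul_mul_transpose hS (isUnit_diagonal fun i => Real.sqrt_pos.mpr (hdiag i))

lemma log_det_rescale (hdiag : ∀ i, 0 < Sig i i) {S : Matrix (Fin d) (Fin d) ℝ}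
    (hS : S.PosDef) :
    Real.log (rescale Sig S).det = Real.log S.det + Real.log (∏ i, Sig i i) := by
  have h1 : (rescale Sig S).det = S.det * ∏ i, Sig i i := by
    rw [rescale, det_mul, det_mul, det_transpose, det_diagonal, mul_comm _ S.det, mul_assoc,
      ← Finset.prod_mul_distrib]
    simp only [Real.mul_self_sqrt (hdiag _).le]
  rw [h1, Real.log_mul hS.det_pos.ne' (Finset.prod_pos fun i _ => hdiag i).ne']

/-- The off-diagonal part of the objective is bounded below in terms of the residue only, since
`Sig` and its residue differ by at most `lam`. -/
lemma mul_trace_rescale_le (hdiag : ∀ i, 0 < Sig i i) {α : ℝ} (hlam : 0 ≤ lam)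
    (hsm : IsSmall (normResidue Sig lam) α) {S : Matrix (Fin d) (Fin d) ℝ} (hS : S.PosDef) :
    (1 - d * α) * (rescale Sig S).trace ≤ (Sig * S).trace + lam * normOneOff S := by
  have hN := posDef_rescale hdiag hS
  rw [trace_mul_add_eq_sum lam (isSymm_of_posDef hS)]
  have h1 : ∀ i j, (if i = j then rescale Sig S i i else 0) -
      α * ((rescale Sig S i i + rescale Sig S j j) / 2) ≤
      Sig i j * S i j + if i = j then 0 else lam * |S i j| := by
    intro i j
    have e0 : 0 ≤ α * ((rescale Sig S i i + rescale Sig S j j) / 2) :=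
      mul_nonneg hsm.nonneg (by linarith [hN.posSemidef.diag_nonneg (i := i),
        hN.posSemidef.diag_nonneg (i := j)])
    split_ifs with hij
    · subst hij
      rw [rescale_apply, Real.mul_self_sqrt (hdiag i).le] at *
      linarith
    · have e1 : |residue Sig lam i j * S i j| ≤
          α * ((rescale Sig S i i + rescale Sig S j j) / 2) := by
        have : residue Sig lam i j * S i j = normResidue Sig lam i j * rescale Sig S i j := by
          rw [residue_eq hdiag, rescale_apply]; ring
        rw [this, abs_mul]
        exact mul_le_mul (hsm.abs_le i j) (abs_apply_le_of_posSemidef hN.posSemidef i j)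
          (abs_nonneg _) hsm.nonneg
      have e2 : |(Sig i j - residue Sig lam i j) * S i j| ≤ lam * |S i j| := by
        rw [abs_mul]
        exact mul_le_mul_of_nonneg_right (abs_sub_residue_le hlam hij) (abs_nonneg _)
      have e3 := neg_abs_le (residue Sig lam i j * S i j)
      have e4 := neg_abs_le ((Sig i j - residue Sig lam i j) * S i j)
      linarith
  refine le_trans (le_of_eq ?_) (Finset.sum_le_sum fun i _ => Finset.sum_le_sum fun j _ => h1 i j)
  simp only [Finset.sum_sub_distrib, ← Finset.mul_sum, ← Finset.sum_div, Finset.sum_add_distrib,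
    sum_const, card_univ, Fintype.card_fin, nsmul_eq_mul, Finset.sum_ite_eq, mem_univ, if_true,
    trace, Matrix.diag_apply]
  ring

/-- A solution is at least as good as `D⁻¹`, which makes its rescaling nearly optimal for
`log det N - trace N`. -/
lemma rescale_near_optimal (hdiag : ∀ i, 0 < Sig i i) {α : ℝ} (hlam : 0 ≤ lam)
    (hsm : IsSmall (normResidue Sig lam) α) {S : Matrix (Fin d) (Fin d) ℝ}
    (hS : IsSolution Sig lam S) :
    (1 - d * α) * (rescale Sig S).trace ≤ d + Real.log (rescale Sig S).det := by
  have h1 := hS.2 (diagonal fun i => (Sig i i)⁻¹) (PosDef.diagonal fun i => inv_pos.mpr (hdiag i))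
  have h2 : objective Sig lam (diagonal fun i => (Sig i i)⁻¹) =
      Real.log (∏ i, Sig i i) + d := by
    have e1 : normOneOff (diagonal fun i => (Sig i i)⁻¹) = 0 := by
      rw [normOneOff_eq]
      refine Finset.sum_eq_zero fun i _ => Finset.sum_eq_zero fun j _ => ?_
      split_ifs with hij
      · rfl
      · simp [hij]
    have e2 : (Sig * diagonal fun i => (Sig i i)⁻¹).trace = d := by
      simp [trace, mul_diagonal, (hdiag _).ne']
    rw [objective, e1, e2, det_diagonal, Finset.prod_inv_distrib, Real.log_inv]
    ring
  have h3 := mul_trace_rescale_le hdiag hlam hsm hS.1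
  rw [log_det_rescale hdiag hS.1]
  rw [h2] at h1
  unfold objective at h1
  linarith

lemma abs_bethe_le {r : Matrix (Fin d) (Fin d) ℝ} {α : ℝ} (h : IsSmall r α) {i j : Fin d}
    (hij : i ≠ j) : |bethe r i j| ≤ 2 * α := by
  have hsq := h.sq_le i j
  have hα := h.nonneg
  have hpos : 0 < 1 - r i j ^ 2 := by linarith
  rw [bethe, of_apply, if_neg hij, abs_div, abs_neg, abs_of_pos hpos, div_le_iff₀ hpos]
  nlinarith [h.abs_le i j]

lemma one_le_bethe_self {r : Matrix (Fin d) (Fin d) ℝ} {α : ℝ} (h : IsSmall r α) (i : Fin d) :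
    1 ≤ bethe r i i := by
  rw [bethe, of_apply, if_pos rfl, le_add_iff_nonneg_right]
  refine Finset.sum_nonneg fun m _ => div_nonneg (sq_nonneg _) ?_
  linarith [h.sq_le i m]

lemma bethe_self_le_two {r : Matrix (Fin d) (Fin d) ℝ} {α : ℝ} (h : IsSmall r α) (i : Fin d) :
    bethe r i i ≤ 2 := by
  have hα := h.nonneg
  have h8 := h.le i.pos
  rw [bethe, of_apply, if_pos rfl]
  have h1 : ∑ m, r i m ^ 2 / (1 - r i m ^ 2) ≤ d * α := by
    refine (le_abs_self _).trans (abs_sum_le_card_mul hα fun m _ => ?_)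
    have hsq := h.sq_le i m
    rw [abs_of_nonneg (div_nonneg (sq_nonneg _) (by linarith)), div_le_iff₀ (by linarith)]
    have := h.abs_le i m
    rw [← sq_abs] at hsq ⊢
    nlinarith [abs_nonneg (r i m)]
  linarith [h.small]

lemma inv_iSup_le_muMax (hd : 0 < d) (hdiag : ∀ i, 0 < Sig i i)
    (hs : ∀ i j, Sig j i = Sig i j) {α : ℝ} (h : IsSmall (normResidue Sig lam) α) :
    1 ≤ muMax (closedForm Sig lam) * ⨆ i, Sig i i := by
  have hA := posDef_closedForm hdiag hs h
  have hS : 0 < ⨆ i, Sig i i := (hdiag ⟨0, hd⟩).trans_le (le_iSup_diag _)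
  have h1 : ∑ _i : Fin d, (1 : ℝ) ≤ (closedForm Sig lam).trace * ⨆ i, Sig i i := by
    rw [trace, Finset.sum_mul]
    refine Finset.sum_le_sum fun i _ => ?_
    have e1 := one_le_bethe_self h i
    rw [← closedForm_apply_mul hdiag hs, Real.mul_self_sqrt (hdiag i).le, mul_comm] at e1
    exact e1.trans (mul_le_mul_of_nonneg_left (le_iSup_diag i) hA.posSemidef.diag_nonneg)
  have h2 := mul_le_mul_of_nonneg_right (trace_le_mul_muMax hA) hS.le
  have hd' : (0 : ℝ) < d := by exact_mod_cast hd
  simp only [sum_const, card_univ, Fintype.card_fin, nsmul_eq_mul, mul_one] at h1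
  rw [mul_assoc] at h2
  exact le_of_mul_le_mul_left (by linarith) hd'

lemma abs_rescale_apply_le (hdiag : ∀ i, 0 < Sig i i) (hs : ∀ i j, Sig j i = Sig i j)
    (h : IsLarge Sig lam) {S : Matrix (Fin d) (Fin d) ℝ} (hS : IsSolution Sig lam S)
    {i j : Fin d} (hij : i ≠ j) : (d : ℝ) ^ 2 * |rescale Sig S i j| ≤ 1 / 2 := by
  have hsm := h.isSmall hs i.pos
  have hd : (0 : ℝ) < d := by exact_mod_cast i.pos
  set a := normMaxOff (normResidue Sig lam)
  have ha : 0 ≤ a := hsm.nonneg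
  -- The choice of `τ` balances the two error terms of `two_mul_abs_apply_le`.
  have h1 := two_mul_abs_apply_le (posDef_rescale hdiag hS.1) (β := d * a)
    (τ := 1 / (8 * (d : ℝ) ^ 3)) (by positivity) hsm.small (by positivity)
    (rescale_near_optimal hdiag h.pos.le hsm hS) hij
  have h2 := h.pow_le i.pos (m := 7) (by omega) (c := 64) le_rfl
  have h3 : (d : ℝ) ^ 2 * |rescale Sig S i j| =
      4 * (d : ℝ) ^ 5 * (2 * (1 / (8 * (d : ℝ) ^ 3)) * |rescale Sig S i j|) := by
    field_simp; ring
  have h4 : 4 * (d : ℝ) ^ 5 * (4 * d * (d * a) + 4 * d * (1 / (8 * (d : ℝ) ^ 3)) ^ 2) =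
      1 / 4 * (64 * d ^ 7 * a) + 1 / 4 := by
    field_simp; ring
  rw [h3]
  refine (mul_le_mul_of_nonneg_left h1 (by positivity)).trans ?_
  rw [h4]
  linarith

/-- Every entry contributes at most `2 d⁻² cycleError` to `trace ((Sig - perturbedInput) (A - S))`.
On the diagonal the perturbation has higher order; off the diagonal the entries of `A` and `S` are
small. -/
lemma sq_mul_entry_le (hdiag : ∀ i, 0 < Sig i i) (hs : ∀ i j, Sig j i = Sig i j)
    (h : IsLarge Sig lam) {S : Matrix (Fin d) (Fin d) ℝ} (hS : IsSolution Sig lam S)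
    (i j : Fin d) : (d : ℝ) ^ 2 * ((Sig - perturbedInput Sig lam) i j *
      (closedForm Sig lam - S) i j) ≤ 2 * cycleError Sig lam := by
  have hsm := h.isSmall hs i.pos
  have hd : (1 : ℝ) ≤ d := by exact_mod_cast i.pos
  have hce := cycleError_nonneg (Sig := Sig) (lam := lam)
  set a := normMaxOff (normResidue Sig lam) with ha_def
  have ha : 0 ≤ a := hsm.nonneg
  have hpos : 0 < √(Sig i i) * √(Sig j j) :=
    mul_pos (Real.sqrt_pos.mpr (hdiag i)) (Real.sqrt_pos.mpr (hdiag j))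
  -- Pass to the normalized matrices.
  have key : ∀ e : ℝ, |(Sig - perturbedInput Sig lam) i j| ≤ √(Sig i i) * √(Sig j j) * e →
      0 ≤ e → (Sig - perturbedInput Sig lam) i j * (closedForm Sig lam - S) i j ≤
      e * (|bethe (normResidue Sig lam) i j| + |rescale Sig S i j|) := by
    intro e he he0
    refine (le_abs_self _).trans ?_
    rw [abs_mul]
    have e1 : √(Sig i i) * √(Sig j j) * |(closedForm Sig lam - S) i j| ≤
        |bethe (normResidue Sig lam) i j| + |rescale Sig S i j| := by
      have : √(Sig i i) * √(Sig j j) * |(closedForm Sig lam - S) i j| =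
          |√(Sig i i) * √(Sig j j) * (closedForm Sig lam - S) i j| := by
        rw [abs_mul, abs_of_pos hpos]
      rw [this, Matrix.sub_apply, mul_sub, closedForm_apply_mul hdiag hs, ← rescale_apply]
      exact abs_sub _ _
    calc _ ≤ √(Sig i i) * √(Sig j j) * e * |(closedForm Sig lam - S) i j| :=
          mul_le_mul_of_nonneg_right he (abs_nonneg _)
      _ = e * (√(Sig i i) * √(Sig j j) * |(closedForm Sig lam - S) i j|) := by ring
      _ ≤ _ := mul_le_mul_of_nonneg_left e1 he0
  by_cases hij : i = j
  · subst hij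
    have e1 := key _ (abs_sub_perturbedInput_self_le hdiag hs h i) (by positivity)
    have hN := posDef_rescale hdiag hS.1
    rw [abs_of_nonneg (zero_le_one.trans (one_le_bethe_self hsm i)),
      abs_of_nonneg hN.posSemidef.diag_nonneg] at e1
    have e2 : bethe (normResidue Sig lam) i i + rescale Sig S i i ≤ 6 * d := by
      have := trace_le_four_mul hN hsm.small (rescale_near_optimal hdiag h.pos.le hsm hS)
      linarith [bethe_self_le_two hsm i, apply_self_le_trace hN.posSemidef i]
    have e3 := h.pow_le i.pos (m := d + 3) (by omega) (c := 24) (by norm_num)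
    calc _ ≤ (d : ℝ) ^ 2 * (4 * d ^ d * a * cycleError Sig lam * (6 * d)) := by
          refine mul_le_mul_of_nonneg_left (e1.trans ?_) (by positivity)
          gcongr
      _ = (24 * (d : ℝ) ^ (d + 3) * a) * cycleError Sig lam := by ring
      _ ≤ 1 * cycleError Sig lam := by gcongr
      _ ≤ _ := by linarith
  · have e1 := key _ (abs_sub_perturbedInput_le hdiag hs h i j) (by positivity)
    have e2 := abs_bethe_le hsm hij
    have e3 := abs_rescale_apply_le hdiag hs h hS hij
    have e4 := h.pow_le i.pos (m := 2) (by omega) (c := 4) (by norm_num)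
    have e5 : (d : ℝ) ^ 2 * |bethe (normResidue Sig lam) i j| ≤ d ^ 2 * (2 * a) := by gcongr
    calc _ ≤ (d : ℝ) ^ 2 * (2 * cycleError Sig lam *
          (|bethe (normResidue Sig lam) i j| + |rescale Sig S i j|)) :=
          mul_le_mul_of_nonneg_left e1 (by positivity)
      _ = 2 * cycleError Sig lam * ((d : ℝ) ^ 2 * |bethe (normResidue Sig lam) i j| +
          (d : ℝ) ^ 2 * |rescale Sig S i j|) := by ring
      _ ≤ 2 * cycleError Sig lam * 1 := by
          gcongr
          linarith
      _ = _ := mul_one _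

lemma objective_eq_add_trace (C C' : Matrix (Fin d) (Fin d) ℝ) (lam : ℝ)
    (M : Matrix (Fin d) (Fin d) ℝ) :
    objective C lam M = objective C' lam M + ((C - C') * M).trace := by
  unfold objective
  rw [sub_mul, trace_sub]; ring

/-- Comparing both matrices in the perturbed problem, which `closedForm` solves, the gap is at most
`trace ((Sig - perturbedInput) (A - S))`. -/
theorem objective_sub_le (hdiag : ∀ i, 0 < Sig i i) (hs : ∀ i j, Sig j i = Sig i j)
    (h : IsLarge Sig lam) (hd : 0 < d) {S : Matrix (Fin d) (Fin d) ℝ}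
    (hS : IsSolution Sig lam S) :
    objective Sig lam (closedForm Sig lam) - objective Sig lam S ≤ 2 * cycleError Sig lam := by
  have hsm := h.isSmall hs hd
  have hA := posDef_closedForm hdiag hs hsm
  have hmin := ((isSolution_perturbedInput hdiag hs h hd _).mpr rfl).2 S hS.1
  have h1 := objective_eq_add_trace Sig (perturbedInput Sig lam) lam (closedForm Sig lam)
  have h2 := objective_eq_add_trace Sig (perturbedInput Sig lam) lam S
  have h3 : ((Sig - perturbedInput Sig lam) * closedForm Sig lam).trace -
      ((Sig - perturbedInput Sig lam) * S).trace =
      ∑ i, ∑ j, (Sig - perturbedInput Sig lam) i j * (closedForm Sig lam - S) i j := by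
    rw [trace_mul_eq_sum (isSymm_of_posDef hA), trace_mul_eq_sum (isSymm_of_posDef hS.1),
      ← Finset.sum_sub_distrib]
    refine Finset.sum_congr rfl fun i _ => ?_
    rw [← Finset.sum_sub_distrib]
    refine Finset.sum_congr rfl fun j _ => ?_
    rw [Matrix.sub_apply (closedForm Sig lam)]; ring
  have hd' : (0 : ℝ) < d := by exact_mod_cast hd
  have hd2 : (0 : ℝ) < (d : ℝ) ^ 2 := by positivity
  have h4 : (d : ℝ) ^ 2 * ∑ i, ∑ j, (Sig - perturbedInput Sig lam) i j *
      (closedForm Sig lam - S) i j ≤ d ^ 2 * (2 * cycleError Sig lam) := by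
    simp only [Finset.mul_sum]
    calc _ ≤ ∑ _i : Fin d, ∑ _j : Fin d, 2 * cycleError Sig lam :=
          Finset.sum_le_sum fun i _ => Finset.sum_le_sum fun j _ =>
            sq_mul_entry_le hdiag hs h hS i j
      _ = _ := by
          simp only [sum_const, card_univ, Fintype.card_fin, nsmul_eq_mul]; ring
  have h5 := le_of_mul_le_mul_left h4 hd2
  linarith

/-! ### The threshold for `lam` -/

lemma normMaxOff_normResidue_le (hlam : 0 ≤ lam) {m B : ℝ} (hm : 0 < m) (hB : 0 ≤ B)
    (hmS : ∀ i, m ≤ Sig i i) (h : ∀ i j, i ≠ j → |Sig i j| ≤ lam + m * B) :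
    normMaxOff (normResidue Sig lam) ≤ B := by
  refine normMaxOff_le hB fun i j hij => ?_
  have h1 : m ≤ √(Sig i i) * √(Sig j j) := by
    rw [← Real.mul_self_sqrt hm.le]
    gcongr
    · exact hmS i
    · exact hmS j
  have h2 := abs_residue_le hlam (mul_nonneg hm.le hB) (h i j hij)
  rw [normResidue_apply, abs_div, abs_of_pos (hm.trans_le h1), div_le_iff₀ (hm.trans_le h1)]
  nlinarith

/-- Every `lam` from some point strictly below the largest off-diagonal entry on is large: there
are finitely many smaller entries, so they stay away from the largest one, while the residue tends
to zero. -/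
theorem exists_forall_isLarge (hd : 0 < d) (hdiag : ∀ i, 0 < Sig i i) :
    ∃ lam0 : ℝ, 0 < lam0 ∧ (0 < normMaxOff Sig → lam0 < normMaxOff Sig) ∧
      ∀ lam, lam0 ≤ lam → IsLarge Sig lam := by
  obtain ⟨m, hm, hmS⟩ := exists_pos_le_diag hd hdiag
  set M := normMaxOff Sig with hM
  have hd' : (0 : ℝ) < d := by exact_mod_cast hd
  have hbig : ∀ lam, 0 < lam → M ≤ lam → IsLarge Sig lam := by
    intro lam hlam hle
    have h0 : normMaxOff (normResidue Sig lam) = 0 :=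
      le_antisymm (normMaxOff_normResidue_le hlam.le hm le_rfl hmS fun i j hij => by
        rw [mul_zero, add_zero]; exact (abs_le_normMaxOff Sig hij).trans hle) (normMaxOff_nonneg _)
    exact ⟨hlam, by rw [h0]; simp, fun i j hij => by rw [h0]; simpa using hij⟩
  rcases (normMaxOff_nonneg Sig).eq_or_lt with h0 | h0
  · exact ⟨1, one_pos, fun h => absurd h0 h.ne, fun lam h =>
      hbig lam (by linarith) (by rw [hM, ← h0]; linarith)⟩
  have ev1 : ∀ᶠ x in nhdsWithin M (Set.Iio M), 0 < x :=
    (eventually_gt_nhds h0).filter_mono nhdsWithin_le_nhds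
  have ev2 : ∀ᶠ x in nhdsWithin M (Set.Iio M), 64 * (d : ℝ) ^ (d + 7) * ((M - x) / m) < 1 := by
    refine Filter.Eventually.filter_mono nhdsWithin_le_nhds ?_
    refine ContinuousAt.eventually_lt (by fun_prop) continuousAt_const (by simp)
  have ev3 : ∀ᶠ x in nhdsWithin M (Set.Iio M), ∀ i j, |Sig i j| < M → |Sig i j| +
      √(Sig i i) * √(Sig j j) * (4 * (d * ((M - x) / m))) < x := by
    refine Filter.Eventually.filter_mono nhdsWithin_le_nhds ?_
    simp only [Filter.eventually_all]
    intro i j hij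
    exact ContinuousAt.eventually_lt (by fun_prop) continuousAt_id (by simpa using hij)
  obtain ⟨x, ⟨⟨h1, h2⟩, h3⟩, h4⟩ := (((ev1.and ev2).and ev3).and self_mem_nhdsWithin).exists
  refine ⟨x, h1, fun _ => h4, fun lam hlam => ?_⟩
  rcases le_or_gt M lam with h5 | h5
  · exact hbig lam (h1.trans_le hlam) h5
  have hB : 0 ≤ (M - x) / m := div_nonneg (by linarith) hm.le
  have h6 : normMaxOff (normResidue Sig lam) ≤ (M - x) / m := by
    refine normMaxOff_normResidue_le (h1.trans_le hlam).le hm hB hmS fun i j hij => ?_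
    rw [mul_div_cancel₀ _ hm.ne']
    linarith [abs_le_normMaxOff Sig hij]
  refine ⟨h1.trans_le hlam, le_trans ?_ h2.le, fun i j hij => ?_⟩
  · gcongr
  · refine le_trans ?_ ((h3 i j (hij.trans_lt h5)).le.trans hlam)
    gcongr

end Perturbation

end GraphicalLasso

end

theorem mainTheorem4 {d : ℕ} (hd : 0 < d) (Sig : Matrix (Fin d) (Fin d) ℝ)
    (hSig : Sig.PosSemidef) (hdiag : ∀ i, 0 < Sig i i) :
    ∃ lam0 : ℝ, 0 < lam0 ∧
      (0 < GraphicalLasso.normMaxOff Sig → lam0 < GraphicalLasso.normMaxOff Sig) ∧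
      ∀ lam : ℝ, lam0 ≤ lam →
        (∃ SigHat : Matrix (Fin d) (Fin d) ℝ, SigHat.IsSymm ∧
          (∀ S : Matrix (Fin d) (Fin d) ℝ, GraphicalLasso.IsSolution SigHat lam S ↔
            S = GraphicalLasso.closedForm Sig lam) ∧
          GraphicalLasso.normTwo (Sig - SigHat) ≤
            (GraphicalLasso.dMax (GraphicalLasso.closedForm Sig lam) : ℝ) *
              (1 / GraphicalLasso.muMin (GraphicalLasso.closedForm Sig lam) + 1) *
              GraphicalLasso.eps Sig lam) ∧
        (∃ Sopt : Matrix (Fin d) (Fin d) ℝ,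
          (∀ S : Matrix (Fin d) (Fin d) ℝ,
            GraphicalLasso.IsSolution Sig lam S ↔ S = Sopt) ∧
          GraphicalLasso.objective Sig lam (GraphicalLasso.closedForm Sig lam) -
              GraphicalLasso.objective Sig lam Sopt ≤
            (GraphicalLasso.muMax (GraphicalLasso.closedForm Sig lam) +
                GraphicalLasso.muMax Sopt) *
              (GraphicalLasso.dMax (GraphicalLasso.closedForm Sig lam) : ℝ) *
              (1 / GraphicalLasso.muMin (GraphicalLasso.closedForm Sig lam) + 1) *
              GraphicalLasso.eps Sig lam) := by
  have hs : ∀ i j, Sig j i = Sig i j := fun i j => by simpa using hSig.1.apply i j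
  obtain ⟨lam0, h0, h1, h2⟩ := GraphicalLasso.exists_forall_isLarge hd hdiag
  refine ⟨lam0, h0, h1, fun lam hlam => ?_⟩
  have h := h2 lam hlam
  have hsm := h.isSmall hs hd
  have hA := GraphicalLasso.posDef_closedForm hdiag hs hsm
  have hS : 0 ≤ ⨆ i, Sig i i := (hdiag ⟨0, hd⟩).le.trans (GraphicalLasso.le_iSup_diag _)
  have hce := GraphicalLasso.cycleError_nonneg (Sig := Sig) (lam := lam)
  have heps := GraphicalLasso.two_mul_cycleError_le_eps (lam := lam) hd hdiag
    (by linarith [hsm.le hd])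
  have heps0 : 0 ≤ GraphicalLasso.eps Sig lam := le_trans (by positivity) heps
  have hdm : (1 : ℝ) ≤ GraphicalLasso.dMax (GraphicalLasso.closedForm Sig lam) := by
    exact_mod_cast GraphicalLasso.one_le_dMax hd _
  have hmu : 1 ≤ 1 / GraphicalLasso.muMin (GraphicalLasso.closedForm Sig lam) + 1 := by
    have := one_div_nonneg.mpr (GraphicalLasso.muMin_nonneg hA)
    linarith
  refine ⟨⟨GraphicalLasso.perturbedInput Sig lam,
    GraphicalLasso.perturbedInput_isSymm hdiag hs hsm,
    GraphicalLasso.isSolution_perturbedInput hdiag hs h hd, ?_⟩, ?_⟩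
  · refine (GraphicalLasso.normTwo_sub_perturbedInput_le hdiag hs h hd).trans ?_
    gcongr
    exact le_mul_of_one_le_right (by positivity) hmu
  · obtain ⟨Sopt, hopt⟩ := GraphicalLasso.exists_isSolution hd hSig hdiag h.pos
    refine ⟨Sopt, fun S => ⟨fun hS => hS.unique h.pos.le hopt, fun hS => hS ▸ hopt⟩, ?_⟩
    refine (GraphicalLasso.objective_sub_le hdiag hs h hd hopt).trans ?_
    set μ := GraphicalLasso.muMax (GraphicalLasso.closedForm Sig lam)
    have hμ : 0 ≤ μ := GraphicalLasso.muMax_nonneg hA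
    have hμ' := GraphicalLasso.muMax_nonneg hopt.1
    -- The largest eigenvalue of the closed form absorbs the factor `Σ_max`.
    calc 2 * GraphicalLasso.cycleError Sig lam
        ≤ (μ * ⨆ i, Sig i i) * (2 * GraphicalLasso.cycleError Sig lam) :=
          le_mul_of_one_le_left (by positivity)
            (GraphicalLasso.inv_iSup_le_muMax hd hdiag hs hsm)
      _ = μ * ((⨆ i, Sig i i) * (2 * GraphicalLasso.cycleError Sig lam)) := by ring
      _ ≤ μ * GraphicalLasso.eps Sig lam := mul_le_mul_of_nonneg_left heps hμ
      _ ≤ _ := by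
          refine mul_le_mul_of_nonneg_right ?_ heps0
          calc μ = μ * 1 * 1 := by ring
            _ ≤ _ := by
              gcongr
              linarith
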